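/- Let $\mathbb T^n=\mathbb R^n/\mathbb Z^n$ and let $\mathrm{Aff}(\mathbb T^n)=\mathrm{GL}(n,\mathbb Z)\ltimes\mathbb T^n$ be the group of affine automorphisms $t\mapsto At+x$ of $\mathbb T^n$. A Lagrangian fibration is a smooth locally trivial fibration $\pi:M\to B$ with compact fibre, where $(M,\omega)$ is a $2n$-dimensional symplectic manifold, $B$ is a connected $n$-dimensional manifold and $\omega$ vanishes on the fibres. When $\pi$ has local action-angle coordinates $(x,t)$ near every fibre (that is, $x$ is a chart of $B$, $t$ takes values in $\mathbb T^n$, and $\omega=\sum_i \mathrm dx^i\wedge\mathrm dt^i$), its associated principal $\mathrm{Aff}(\mathbb T^n)$-bundle is the bundle whose fibre over $b$ is the set of parametrisations $\mathbb T^n\to\pi^{-1}(b)$ given by the angles of such coordinates. If $f:B\to \mathrm B\mathrm{Aff}(\mathbb T^n)$ is a classifying map of this bundle, the monodromy of the fibration is the induced map $f_*:\pi_1(B)\to\pi_1(\mathrm B\mathrm{Aff}(\mathbb T^n))\cong\pi_0(\mathrm{Aff}(\mathbb T^n))=\mathrm{GL}(n,\mathbb Z)$, which is well defined up to conjugation.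 The base $B$ carries a flat connection on $\mathrm T^*B$, for which the differentials $\mathrm dx^i$ of all action coordinates are parallel. Let $X=(\mathbb R^3\setminus\{0\})/(x\sim -x)$ and $M_0=\big((\mathbb R^3\setminus\{0\})\times\mathbb T^3\big)/\big((x,t)\sim(-x,-t)\big)$, with the smooth structures of the quotients, and let $M_0\to X$ be the map $[x,t]\mapsto[x]$. Then: 1. The form $\sum_{i=1}^3\mathrm dx^i\wedge\mathrm dt^i$ descends to a symplectic form on $M_0$, for which $M_0\to X$ is a Lagrangian fibration with fibre $\mathbb T^3$. The map $[x]\mapsto([x],\log\|x\|)$ is a homeomorphism $X\to\mathbb R\mathrm P^2\times\mathbb R$. 2. For every base point $b\in X$ the group $\pi_1(X,b)$ has order $2$. Let $a$ be its generator. The monodromy of $M_0\to X$ sends $a$ to $-I\in\mathrm{GL}(3,\mathbb Z)$. 3. For every loop at $b$ in the class $a$, the holonomy along it of the flat connection on $\mathrm T^*X$ is $-\mathrm{id}$. -/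

import Mathlib

open scoped Manifold ContDiff Topology unitInterval LinearAlgebra.Projectivization

namespace LagFib

noncomputable section

/-- The torus `𝕋ⁿ = ℝⁿ / ℤⁿ`. -/
abbrev Torus (n : ℕ) := Fin n → UnitAddCircle

/-- The universal covering `ℝⁿ → 𝕋ⁿ`. -/
def toTorus {n : ℕ} (s : EuclideanSpace ℝ (Fin n)) : Torus n := fun i => (s i : UnitAddCircle)

/-! ### The group of affine toral automorphisms -/

section Aff

open scoped Matrix.Module

/-- `Aff(𝕋ⁿ) = GL(n,ℤ) ⋉ 𝕋ⁿ`. -/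
@[ext] structure AffTorus (n : ℕ) where
  lin : GL (Fin n) ℤ
  trans : Torus n

namespace AffTorus

variable {n : ℕ}

/-- The action of `Aff(𝕋ⁿ)` on `𝕋ⁿ`: `(A, x) · t = A t + x`. -/
def act (g : AffTorus n) (t : Torus n) : Torus n :=
  (g.lin : Matrix (Fin n) (Fin n) ℤ) • t + g.trans

/-- `(A, x) · (B, y) = (A B, A y + x)`. -/
instance : Mul (AffTorus n) :=
  ⟨fun g h => ⟨g.lin * h.lin, (g.lin : Matrix (Fin n) (Fin n) ℤ) • h.trans + g.trans⟩⟩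

instance : One (AffTorus n) := ⟨⟨1, 0⟩⟩

instance : Inv (AffTorus n) :=
  ⟨fun g => ⟨g.lin⁻¹, -(((g.lin⁻¹ : GL (Fin n) ℤ) : Matrix (Fin n) (Fin n) ℤ) • g.trans)⟩⟩

@[simp] theorem mul_lin (g h : AffTorus n) : (g * h).lin = g.lin * h.lin := rfl

@[simp] theorem mul_trans (g h : AffTorus n) :
    (g * h).trans = (g.lin : Matrix (Fin n) (Fin n) ℤ) • h.trans + g.trans := rfl

@[simp] theorem one_lin : (1 : AffTorus n).lin = 1 := rfl

@[simp] theorem one_trans : (1 : AffTorus n).trans = 0 := rfl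

@[simp] theorem inv_lin (g : AffTorus n) : (g⁻¹).lin = g.lin⁻¹ := rfl

@[simp] theorem inv_trans (g : AffTorus n) : (g⁻¹).trans =
    -(((g.lin⁻¹ : GL (Fin n) ℤ) : Matrix (Fin n) (Fin n) ℤ) • g.trans) := rfl

instance : Group (AffTorus n) :=
  Group.ofLeftAxioms
    (fun a b c => by
      apply AffTorus.ext
      · simp [mul_assoc]
      · simp only [mul_trans, mul_lin, Units.val_mul, mul_smul, smul_add, add_assoc])
    (fun a => by
      apply AffTorus.ext
      · simp
      · simp only [mul_trans, one_lin, one_trans, Units.val_one, one_smul, add_zero])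
    (fun a => by
      apply AffTorus.ext
      · simp
      · simp only [mul_trans, inv_lin, inv_trans, one_trans, add_neg_cancel])

/-- The topology of `GL(n,ℤ) × 𝕋ⁿ`, where `GL(n,ℤ)` is discrete. -/
instance : TopologicalSpace (AffTorus n) :=
  TopologicalSpace.induced (fun g => (g.lin, g.trans)) inferInstance

end AffTorus

end Aff

/-! ### The classifying space of a topological group -/

section Milnor

variable (G : Type*) [Group G] [TopologicalSpace G]

/-- Milnor's model of `EG`, the infinite join `G * G * G * ⋯`: a point consists of barycentric
coordinates `wt i` and, for each `i` with `wt i ≠ 0`, an element of `G`. -/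
structure MilnorE where
  wt : ℕ → ℝ
  wt_nonneg : ∀ i, 0 ≤ wt i
  wt_finite : (Function.support wt).Finite
  wt_sum : ∑ᶠ i, wt i = 1
  coord : ∀ i, wt i ≠ 0 → G

/-- The coarsest topology for which the functions `wt i` and the partially defined functions
`coord i : {wt i ≠ 0} → G` are continuous. -/
instance : TopologicalSpace (MilnorE G) :=
  TopologicalSpace.generateFrom
    ({S | ∃ (i : ℕ) (U : Set ℝ), IsOpen U ∧ S = {p | p.wt i ∈ U}} ∪
      {S | ∃ (i : ℕ) (V : Set G), IsOpen V ∧ S = {p | ∃ h : p.wt i ≠ 0, p.coord i h ∈ V}})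

/-- `G` acts on `EG` by multiplication on all the group coordinates. -/
instance : MulAction G (MilnorE G) where
  smul g p := { p with coord := fun i h => g * p.coord i h }
  one_smul p := by
    change MilnorE.mk _ _ _ _ _ = p
    simp
  mul_smul g h p := by
    change MilnorE.mk p.wt _ _ _ (fun i k => g * h * p.coord i k) =
      MilnorE.mk p.wt _ _ _ (fun i k => g * (h * p.coord i k))
    simp [mul_assoc]

/-- The classifying space `BG = EG / G`. -/
abbrev ClassifyingSpace := Quotient (MulAction.orbitRel G (MilnorE G))

end Milnor

/-- The isomorphism `π₁(BAff(𝕋ⁿ)) ≅ π₀(Aff(𝕋ⁿ)) = GL(n,ℤ)`, as a relation: it is the connecting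
map of `Aff(𝕋ⁿ) → EAff(𝕋ⁿ) → BAff(𝕋ⁿ)`. A loop at `x` lifts to a path in `EAff(𝕋ⁿ)` that starts
at a point `e` over `x` and ends at `g • e`; the loop corresponds to the linear part of `g`.
(The point `e` is arbitrary, which is the usual ambiguity up to conjugation.) -/
def IsBoundary {n : ℕ} (x : ClassifyingSpace (AffTorus n))
    (β : FundamentalGroup (ClassifyingSpace (AffTorus n)) x) (A : GL (Fin n) ℤ) : Prop :=
  ∃ (e : MilnorE (AffTorus n)) (g : AffTorus n) (p : Path e (g • e)) (loop : Path x x),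
    (∀ s, loop s = ⟦p s⟧) ∧ FundamentalGroup.fromPath ⟦loop⟧ = β ∧ g.lin = A

/-! ### Lagrangian fibrations -/

/-- The standard symplectic form `∑ dxⁱ ∧ dtⁱ` on `ℝⁿ × ℝⁿ`. -/
def stdForm {n : ℕ} (v w : EuclideanSpace ℝ (Fin n) × EuclideanSpace ℝ (Fin n)) : ℝ :=
  ∑ i, (v.1 i * w.2 i - v.2 i * w.1 i)

section Lagrangian

variable {E : Type*} [NormedAddCommGroup E] [NormedSpace ℝ E]
  {M : Type*} [TopologicalSpace M] [ChartedSpace E M]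
  {E' : Type*} [NormedAddCommGroup E'] [NormedSpace ℝ E']
  {B : Type*} [TopologicalSpace B] [ChartedSpace E' B]

/-- The coefficient, on constant vector fields `u` and `v`, of a `2`-form in the chart at `c`. -/
def formInChart (Ω : ∀ m : M, TangentSpace 𝓘(ℝ, E) m → TangentSpace 𝓘(ℝ, E) m → ℝ)
    (c : M) (u v : E) (y : E) : ℝ :=
  Ω ((chartAt E c).symm y)
    (mfderiv 𝓘(ℝ, E) 𝓘(ℝ, E) (chartAt E c).symm y u)
    (mfderiv 𝓘(ℝ, E) 𝓘(ℝ, E) (chartAt E c).symm y v)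

/-- `Ω` is a symplectic form on the manifold `M`: a smooth closed nondegenerate `2`-form. -/
structure IsSymplecticForm
    (Ω : ∀ m : M, TangentSpace 𝓘(ℝ, E) m → TangentSpace 𝓘(ℝ, E) m → ℝ) : Prop where
  add_left : ∀ m u v w, Ω m (u + v) w = Ω m u w + Ω m v w
  smul_left : ∀ m (r : ℝ) u v, Ω m (r • u) v = r * Ω m u v
  skew : ∀ m u v, Ω m u v = -Ω m v u
  nondegenerate : ∀ m u, (∀ v, Ω m u v = 0) → u = 0
  smooth : ∀ c u v, ContDiffOn ℝ ∞ (formInChart Ω c u v) (chartAt E c).target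
  closed : ∀ (c : M) (y : E) (u v w : E), y ∈ (chartAt E c).target →
    fderiv ℝ (formInChart Ω c v w) y u + fderiv ℝ (formInChart Ω c w u) y v
      + fderiv ℝ (formInChart Ω c u v) y w = 0

variable (E')

/-- `F → M → B` is a Lagrangian fibration: `(M, Ω)` is a symplectic manifold of dimension `2n`,
`B` is a connected manifold of dimension `n`, `F` is compact, `π` is a smooth locally trivial
submersion with fibre `F`, and `Ω` vanishes on the fibres of `π`. -/
structure IsLagrangianFibration (n : ℕ) (F : Type*) [TopologicalSpace F]
    (Ω : ∀ m : M, TangentSpace 𝓘(ℝ, E) m → TangentSpace 𝓘(ℝ, E) m → ℝ) (π : M → B) : Prop where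
  manifold_total : IsManifold 𝓘(ℝ, E) ∞ M
  t2_total : T2Space M
  countable_total : SecondCountableTopology M
  dim_total : Module.finrank ℝ E = 2 * n
  finite_total : FiniteDimensional ℝ E
  manifold_base : IsManifold 𝓘(ℝ, E') ∞ B
  t2_base : T2Space B
  countable_base : SecondCountableTopology B
  dim_base : Module.finrank ℝ E' = n
  finite_base : FiniteDimensional ℝ E'
  connected_base : ConnectedSpace B
  symplectic : IsSymplecticForm Ω
  compact_fibre : CompactSpace F
  smooth : ContMDiff 𝓘(ℝ, E) 𝓘(ℝ, E') ∞ π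
  submersion : ∀ m, Function.Surjective (mfderiv 𝓘(ℝ, E) 𝓘(ℝ, E') π m)
  locally_trivial : ∀ b, ∃ e : Bundle.Trivialization F π, b ∈ e.baseSet
  lagrangian : ∀ m u v, mfderiv 𝓘(ℝ, E) 𝓘(ℝ, E') π m u = 0 →
    mfderiv 𝓘(ℝ, E) 𝓘(ℝ, E') π m v = 0 → Ω m u v = 0

/-- Local action-angle coordinates `(x, t)` on `π⁻¹(U)`, where `U ⊆ B` is open: `x` is a smooth
chart with domain `U`, `(π, t) : π⁻¹(U) → U × 𝕋ⁿ` is a trivialisation, and the parametrisation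
`(x, t) ↦ m` of `π⁻¹(U)` is smooth and pulls `Ω` back to `∑ dxⁱ ∧ dtⁱ`. -/
structure ActionAngleChart (n : ℕ)
    (Ω : ∀ m : M, TangentSpace 𝓘(ℝ, E) m → TangentSpace 𝓘(ℝ, E) m → ℝ) (π : M → B) where
  action : OpenPartialHomeomorph B (EuclideanSpace ℝ (Fin n))
  triv : Bundle.Trivialization (Torus n) π
  baseSet_eq : triv.baseSet = action.source
  smooth_action :
    ContMDiffOn 𝓘(ℝ, E') 𝓘(ℝ, EuclideanSpace ℝ (Fin n)) ∞ action action.source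
  smooth_action_symm :
    ContMDiffOn 𝓘(ℝ, EuclideanSpace ℝ (Fin n)) 𝓘(ℝ, E') ∞ action.symm action.target
  smooth_param :
    ContMDiffOn 𝓘(ℝ, EuclideanSpace ℝ (Fin n) × EuclideanSpace ℝ (Fin n)) 𝓘(ℝ, E) ∞
      (fun y => triv.toOpenPartialHomeomorph.symm (action.symm y.1, toTorus y.2))
      (action.target ×ˢ Set.univ)
  symplectic : ∀ (y v w : EuclideanSpace ℝ (Fin n) × EuclideanSpace ℝ (Fin n)),
    y.1 ∈ action.target →
    Ω (triv.toOpenPartialHomeomorph.symm (action.symm y.1, toTorus y.2))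
      (mfderiv 𝓘(ℝ, EuclideanSpace ℝ (Fin n) × EuclideanSpace ℝ (Fin n)) 𝓘(ℝ, E)
        (fun y => triv.toOpenPartialHomeomorph.symm (action.symm y.1, toTorus y.2)) y v)
      (mfderiv 𝓘(ℝ, EuclideanSpace ℝ (Fin n) × EuclideanSpace ℝ (Fin n)) 𝓘(ℝ, E)
        (fun y => triv.toOpenPartialHomeomorph.symm (action.symm y.1, toTorus y.2)) y w)
      = stdForm v w

variable (n : ℕ) (Ω : ∀ m : M, TangentSpace 𝓘(ℝ, E) m → TangentSpace 𝓘(ℝ, E) m → ℝ) (π : M → B)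

/-- The principal `Aff(𝕋ⁿ)`-bundle associated to a Lagrangian fibration. Its fibre over `b`
consists of the parametrisations `𝕋ⁿ → π⁻¹(b)` given by the angles of action-angle coordinates
near `b`; the topology is the compact-open one. -/
abbrev FrameBundle :=
  {φ : C(Torus n, M) // ∃ (c : ActionAngleChart E' n Ω π) (b : B), b ∈ c.action.source ∧
    ∀ t, φ t = c.triv.toOpenPartialHomeomorph.symm (b, t)}

/-- `f : B → BAff(𝕋ⁿ)` is a classifying map of the associated principal bundle, that is, it is
covered by a continuous `Aff(𝕋ⁿ)`-equivariant map into `EAff(𝕋ⁿ)`. Here `g` acts on frames by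
`g • φ = φ ∘ g⁻¹`. -/
def IsClassifyingMap (f : C(B, ClassifyingSpace (AffTorus n))) : Prop :=
  ∃ F : C(FrameBundle E' n Ω π, MilnorE (AffTorus n)),
    (∀ (g : AffTorus n) (φ ψ : FrameBundle E' n Ω π), (∀ t, ψ.1 (g.act t) = φ.1 t) → F ψ = g • F φ) ∧
    ∀ φ : FrameBundle E' n Ω π, f (π (φ.1 0)) = ⟦F φ⟧

/-- `A ∈ GL(n,ℤ)` is a value at `a ∈ π₁(B, b)` of the monodromy
`f_* : π₁(B) → π₁(BAff(𝕋ⁿ)) ≅ GL(n,ℤ)` of the Lagrangian fibration `π`, where `f` is a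
classifying map. The monodromy is defined up to conjugation. -/
def IsMonodromy (b : B) (a : FundamentalGroup B b) (A : GL (Fin n) ℤ) : Prop :=
  ∃ f : C(B, ClassifyingSpace (AffTorus n)), IsClassifyingMap E' n Ω π f ∧
    IsBoundary (f b) (FundamentalGroup.map f b a) A

variable {E'}

/-- The differentials `(dx¹, …, dxⁿ)` at `b` of the action coordinates. -/
def ActionAngleChart.dAction {n : ℕ}
    {Ω : ∀ m : M, TangentSpace 𝓘(ℝ, E) m → TangentSpace 𝓘(ℝ, E) m → ℝ} {π : M → B}
    (c : ActionAngleChart E' n Ω π) (b : B) :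
    TangentSpace 𝓘(ℝ, E') b →L[ℝ] EuclideanSpace ℝ (Fin n) :=
  mfderiv 𝓘(ℝ, E') 𝓘(ℝ, EuclideanSpace ℝ (Fin n)) c.action b

variable (E')

/-- A field of covectors along a path is parallel for the flat connection of the integral affine
structure of `B` if it is locally a linear combination with constant coefficients of the
differentials of action coordinates. -/
def IsParallelAlong {b₀ b₁ : B} (γ : Path b₀ b₁)
    (l : ∀ s : I, TangentSpace 𝓘(ℝ, E') (γ s) →L[ℝ] ℝ) : Prop :=
  ∀ s₀ : I, ∃ (c : ActionAngleChart E' n Ω π) (k : Fin n → ℝ), γ s₀ ∈ c.action.source ∧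
    ∀ᶠ s in 𝓝 s₀, ∀ v, l s v = ∑ i, k i * c.dAction (γ s) v i

/-- The covector `β` at the endpoint is the parallel transport along `γ` of the covector `α`. -/
def IsParallelTransport {b₀ b₁ : B} (γ : Path b₀ b₁)
    (α : TangentSpace 𝓘(ℝ, E') b₀ →L[ℝ] ℝ) (β : TangentSpace 𝓘(ℝ, E') b₁ →L[ℝ] ℝ) : Prop :=
  ∃ l : ∀ s : I, TangentSpace 𝓘(ℝ, E') (γ s) →L[ℝ] ℝ,
    IsParallelAlong E' n Ω π γ l ∧
      l 0 = (γ.source.symm ▸ α : TangentSpace 𝓘(ℝ, E') (γ 0) →L[ℝ] ℝ) ∧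
      l 1 = (γ.target.symm ▸ β : TangentSpace 𝓘(ℝ, E') (γ 1) →L[ℝ] ℝ)

end Lagrangian

/-! ### The fibration `M₀ → X` -/

abbrev R3 := EuclideanSpace ℝ (Fin 3)

/-- `X̃ = ℝ³ ∖ 0`. -/
abbrev XTilde := {x : R3 // x ≠ 0}

/-- The group `ℤˣ = {1, -1} ≅ ℤ₂` acts on `ℝ³ ∖ 0` by `-1 • x = -x`. -/
instance : MulAction ℤˣ XTilde where
  smul a x := ⟨a • (x : R3), by
    rcases Int.units_eq_one_or a with rfl | rfl <;> simpa using x.2⟩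
  one_smul x := Subtype.ext (one_smul ℤˣ (x : R3))
  mul_smul a b x := Subtype.ext (mul_smul a b (x : R3))

theorem coe_smul (a : ℤˣ) (x : XTilde) : ((a • x : XTilde) : R3) = a • (x : R3) := rfl

/-- `X = (ℝ³ ∖ 0) / (x ∼ -x)`. -/
abbrev X := Quotient (MulAction.orbitRel ℤˣ XTilde)

/-- `M₀ = ((ℝ³ ∖ 0) × 𝕋³) / ((x, t) ∼ (-x, -t))`. -/
abbrev M0 := Quotient (MulAction.orbitRel ℤˣ (XTilde × Torus 3))

/-- The projection `M₀ → X`, `[x, t] ↦ [x]`. -/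
def proj0 : M0 → X :=
  Quotient.map Prod.fst (by
    rintro p q ⟨a, rfl⟩
    exact ⟨a, rfl⟩)

/-- The covering `ℝ³ ∖ 0 → X`. -/
def coverX (x : XTilde) : X := ⟦x⟧

/-- The covering `(ℝ³ ∖ 0) × ℝ³ → M₀`. -/
def coverM0 (y : XTilde × R3) : M0 := ⟦(y.1, toTorus y.2)⟧

instance : ContinuousConstSMul ℤˣ XTilde where
  continuous_const_smul a := by
    refine Continuous.subtype_mk ?_ _
    rcases Int.units_eq_one_or a with rfl | rfl
    · simpa using continuous_subtype_val
    · simpa [Function.comp_def] using continuous_neg.comp continuous_subtype_val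

instance : ContinuousConstSMul ℤˣ (Torus 3) where
  continuous_const_smul a := by
    rcases Int.units_eq_one_or a with rfl | rfl
    · simpa using continuous_id'
    · simpa using continuous_neg

theorem units_eq_one_of_smul_eq (a : ℤˣ) (x : XTilde) (h : a • x = x) : a = 1 := by
  rcases Int.units_eq_one_or a with rfl | rfl
  · rfl
  · exfalso
    have h' : -(x : R3) = x := by
      have := congrArg Subtype.val h
      simpa [coe_smul] using this
    have h2 : (2 : ℝ) • (x : R3) = 0 := by
      rw [two_smul]
      nth_rewrite 1 [← h']
      exact neg_add_cancel _
    exact x.2 ((smul_eq_zero.mp h2).resolve_left two_ne_zero)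

instance : IsCancelSMul ℤˣ XTilde :=
  isCancelSMul_iff_eq_one_of_smul_eq.mpr units_eq_one_of_smul_eq

instance : IsCancelSMul ℤˣ (XTilde × Torus 3) :=
  isCancelSMul_iff_eq_one_of_smul_eq.mpr fun a p h =>
    units_eq_one_of_smul_eq a p.1 (congrArg Prod.fst h)

instance : LocallyCompactSpace XTilde :=
  (isOpen_ne : IsOpen {x : R3 | x ≠ 0}).locallyCompactSpace

theorem isLocalHomeomorph_coverX : IsLocalHomeomorph coverX :=
  (isQuotientCoveringMap_quotientMk_of_properlyDiscontinuousSMul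
    (G := ℤˣ) (E := XTilde)).isCoveringMap.isLocalHomeomorph

theorem isLocalHomeomorph_toTorus (n : ℕ) : IsLocalHomeomorph (toTorus (n := n)) := by
  have h : IsLocalHomeomorph (fun (s : Fin n → ℝ) i => (s i : UnitAddCircle)) := by
    intro s
    choose e he hee using fun i => AddCircle.isLocalHomeomorph_coe (1 : ℝ) (s i)
    refine ⟨OpenPartialHomeomorph.pi e, fun i _ => he i, ?_⟩
    funext s' i
    exact congrFun (hee i) (s' i)
  exact h.comp (PiLp.homeomorph 2 (fun _ : Fin n => ℝ)).isLocalHomeomorph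

theorem isLocalHomeomorph_coverM0 : IsLocalHomeomorph coverM0 := by
  have h1 : IsLocalHomeomorph (fun y : XTilde × R3 => (y.1, toTorus y.2)) := by
    intro y
    obtain ⟨e, he, hee⟩ := isLocalHomeomorph_toTorus 3 y.2
    refine ⟨(OpenPartialHomeomorph.refl XTilde).prod e, ⟨trivial, he⟩, ?_⟩
    funext y'
    simp [hee]
  exact (isQuotientCoveringMap_quotientMk_of_properlyDiscontinuousSMul
    (G := ℤˣ) (E := XTilde × Torus 3)).isCoveringMap.isLocalHomeomorph.comp h1

theorem surjective_coverX : Function.Surjective coverX := Quotient.mk_surjective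

theorem surjective_coverM0 : Function.Surjective coverM0 := by
  intro m
  obtain ⟨⟨x, t⟩, rfl⟩ := Quotient.mk_surjective m
  choose s hs using fun i => QuotientAddGroup.mk_surjective (t i)
  have h : toTorus (WithLp.toLp 2 s) = t := funext hs
  exact ⟨(x, WithLp.toLp 2 s), by simp only [coverM0, h]⟩

instance : Nonempty XTilde := ⟨⟨EuclideanSpace.single 0 1, by simp⟩⟩

/-- The manifold structure on the image of a local homeomorphism `q : Y → Z` where `Y` is
(identified by `j` with) an open subset of `H`: the charts are the local inverses of `q`. -/
@[reducible] def chartedSpaceOfCover {H Y Z : Type*} [TopologicalSpace H] [TopologicalSpace Y]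
    [TopologicalSpace Z] [Nonempty Y] (j : Y → H) (hj : Topology.IsOpenEmbedding j) (q : Y → Z)
    (hq : IsLocalHomeomorph q) (hs : Function.Surjective q) : ChartedSpace H Z where
  atlas := {c | ∃ e : OpenPartialHomeomorph Y Z, ⇑e = q ∧
    c = e.symm.trans (hj.toOpenPartialHomeomorph j)}
  chartAt z := (hq (hs z).choose).choose.symm.trans (hj.toOpenPartialHomeomorph j)
  mem_chart_source z := by
    have h := (hq (hs z).choose).choose_spec
    have hz := (hs z).choose_spec
    simp only [OpenPartialHomeomorph.trans_source, OpenPartialHomeomorph.symm_source,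
      Topology.IsOpenEmbedding.toOpenPartialHomeomorph_source, Set.preimage_univ, Set.inter_univ]
    have := (hq (hs z).choose).choose.map_source h.1
    rwa [← h.2, hz] at this
  chart_mem_atlas z := ⟨_, (hq (hs z).choose).choose_spec.2.symm, rfl⟩

theorem isOpenEmbedding_val : Topology.IsOpenEmbedding (Subtype.val : XTilde → R3) :=
  (isOpen_ne : IsOpen {x : R3 | x ≠ 0}).isOpenEmbedding_subtypeVal

/-- The smooth structure of `X`, for which `ℝ³ ∖ 0 → X` is a local diffeomorphism. -/
instance : ChartedSpace R3 X :=
  chartedSpaceOfCover _ isOpenEmbedding_val coverX isLocalHomeomorph_coverX surjective_coverX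

/-- The smooth structure of `M₀`, for which `(ℝ³ ∖ 0) × ℝ³ → M₀` is a local diffeomorphism. -/
instance : ChartedSpace (R3 × R3) M0 :=
  chartedSpaceOfCover _ (isOpenEmbedding_val.prodMap Topology.IsOpenEmbedding.id)
    coverM0 isLocalHomeomorph_coverM0 surjective_coverM0

/-- The symplectic form of `M₀`, induced by `∑ dxⁱ ∧ dtⁱ` on `(ℝ³ ∖ 0) × ℝ³`: it is the pullback
at `m` of `∑ dxⁱ ∧ dtⁱ` by the local inverse of the covering that is the chart at `m`. -/
def omega0 (m : M0) (v w : TangentSpace 𝓘(ℝ, R3 × R3) m) : ℝ :=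
  stdForm (n := 3)
    (mfderiv 𝓘(ℝ, R3 × R3) 𝓘(ℝ, R3 × R3) (chartAt (R3 × R3) m) m v)
    (mfderiv 𝓘(ℝ, R3 × R3) 𝓘(ℝ, R3 × R3) (chartAt (R3 × R3) m) m w)

/-- The quotient topology on the real projective plane. -/
instance : TopologicalSpace (ℙ ℝ R3) :=
  inferInstanceAs (TopologicalSpace (Quotient (projectivizationSetoid ℝ R3)))

end

end LagFib

namespace LagFib

/-! ### Simple connectedness of a union of two open sets -/

section VanKampen

variable {Z : Type*} [TopologicalSpace Z]

/-! Everything is computed on the double cover `ℝ³ ∖ 0 → X` with deck group `{1, -1}`. The cover is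
simply connected, so `π₁(X)` has order two, and a loop in the nontrivial class is exactly one whose
lift runs from `x` to `-x`. The charts of `X` and `M0` are inverse branches of the coverings, so
their transitions are locally `h ↦ ±h + k`. The form `∑ dxⁱ ∧ dtⁱ` is insensitive to the sign and
the translation, hence descends, with constant coefficients in every chart (`formInChart_omega0`).

The definitions of monodromy and flat connection quantify over all action-angle charts, so an
arbitrary chart must be compared with the standard ones. Let `A` be the Jacobian of its actions with
respect to a chart of `X`. The symplectic condition forces the standard angles to have derivative
`Aᵀ` in the new angles (`fderiv_angle`). This is constant on a fibre, so the change of angles is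
affine; it is a bijection of tori, so `Aᵀ` lies in `GL(3,ℤ)` (`exists_frame_eq`). Thus every frame
is the standard one composed with an element of `Aff(𝕋³)`, and `A`, being continuous and integral,
is locally constant (`eventually_fderiv_eq`).

Monodromy: along a lift from `x` to `-x` the standard frames end at the initial one composed with `t
↦ -t`, so any equivariant map to `EAff` yields a path from `e` to `negAff • e`. To see that no other
matrix can occur, lifts are pushed to `E GL(3,ℤ)`, which covers `B GL(3,ℤ)` because the group is
discrete; there lifts of homotopic loops are rigid up to conjugation (`conj_of_homotopic_loops`),
and `-I` is central. A classifying map is built from the partition of unity `xᵢ² / ‖x‖²`.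

Holonomy: pulled back to `ℝ³ ∖ 0`, a parallel covector field is a constant covector, and the
identifications of the tangent space of `X` at the two ends of the lift differ by the sign
(`sectDeriv_neg`). -/

theorem homotopic_of_mem_simplyConnected {S : Set Z} [SimplyConnectedSpace S] {x y : Z}
    (p q : Path x y) (hp : ∀ t, p t ∈ S) (hq : ∀ t, q t ∈ S) : p.Homotopic q := by
  have hx : x ∈ S := by simpa using hp 0
  have hy : y ∈ S := by simpa using hp 1
  let p' : Path (⟨x, hx⟩ : S) ⟨y, hy⟩ :=
    { toFun := fun t => ⟨p t, hp t⟩, source' := by simp, target' := by simp }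
  let q' : Path (⟨x, hx⟩ : S) ⟨y, hy⟩ :=
    { toFun := fun t => ⟨q t, hq t⟩, source' := by simp, target' := by simp }
  exact (SimplyConnectedSpace.paths_homotopic p' q').map ⟨Subtype.val, continuous_subtype_val⟩

/-- Each `x` gets a path `c x` from a base point in `U ∩ V` that stays in whichever of the two sets
contain `x`; for `x ∈ U ∩ V` this needs path connectedness of the intersection. A path `q` inside
one piece then closes a triangle with `c x` and `c y` inside that simply connected piece.
Subdividing an arbitrary path into such pieces shows that it is homotopic to `(c x)⁻¹ · c y`, which
depends only on the end points. -/
theorem simplyConnectedSpace_of_union {U V : Set Z} (hU : IsOpen U) (hV : IsOpen V)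
    (hUV : ∀ z, z ∈ U ∨ z ∈ V) [SimplyConnectedSpace U] [SimplyConnectedSpace V]
    (hI : IsPathConnected (U ∩ V)) : SimplyConnectedSpace Z := by
  obtain ⟨x₀, hx₀⟩ := hI.nonempty
  have pcU : IsPathConnected U := isPathConnected_iff_pathConnectedSpace.2 inferInstance
  have pcV : IsPathConnected V := isPathConnected_iff_pathConnectedSpace.2 inferInstance
  have hex : ∀ x, ∃ p : Path x₀ x, (x ∈ U → ∀ t, p t ∈ U) ∧ (x ∈ V → ∀ t, p t ∈ V) := by
    intro x
    by_cases hxU : x ∈ U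
    · by_cases hxV : x ∈ V
      · have h := hI.joinedIn x₀ hx₀ x ⟨hxU, hxV⟩
        exact ⟨h.somePath, fun _ t => (h.somePath_mem t).1, fun _ t => (h.somePath_mem t).2⟩
      · have h := pcU.joinedIn x₀ hx₀.1 x hxU
        exact ⟨h.somePath, fun _ t => h.somePath_mem t, fun h' => absurd h' hxV⟩
    · have hxV := (hUV x).resolve_left hxU
      have h := pcV.joinedIn x₀ hx₀.2 x hxV
      exact ⟨h.somePath, fun h' => absurd h' hxU, fun _ t => h.somePath_mem t⟩
  choose c hcU hcV using hex
  have small : ∀ {x y : Z} (q : Path x y), ((∀ t, q t ∈ U) ∨ ∀ t, q t ∈ V) →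
      ((c x).trans q).Homotopic (c y) := by
    intro x y q hq
    have aux : ∀ {S : Set Z} {x₁ x₂ x₃ : Z} (p₁ : Path x₁ x₂) (p₂ : Path x₂ x₃),
        (∀ t, p₁ t ∈ S) → (∀ t, p₂ t ∈ S) → ∀ t, p₁.trans p₂ t ∈ S := by
      intro S x₁ x₂ x₃ p₁ p₂ h₁ h₂ t
      rw [Path.trans_apply]
      split_ifs
      exacts [h₁ _, h₂ _]
    rcases hq with hq | hq
    · have hx : x ∈ U := by simpa using hq 0
      have hy : y ∈ U := by simpa using hq 1
      exact homotopic_of_mem_simplyConnected (S := U) _ _ (aux _ _ (hcU x hx) hq) (hcU y hy)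
    · have hx : x ∈ V := by simpa using hq 0
      have hy : y ∈ V := by simpa using hq 1
      exact homotopic_of_mem_simplyConnected (S := V) _ _ (aux _ _ (hcV x hx) hq) (hcV y hy)
  have key : ∀ {x y : Z} (γ : Path x y), ((c x).trans γ).Homotopic (c y) := by
    intro x y γ
    obtain ⟨t, t_0, t_mono, ⟨n, hn⟩, t_sub⟩ :=
      exists_monotone_Icc_subset_open_cover_unitInterval
      (c := fun b : Bool => γ ⁻¹' (if b then U else V))
      (fun b => (by cases b <;> simpa : IsOpen (if b then U else V)).preimage γ.continuous)
      (fun s _ => Set.mem_iUnion.2 (by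
        rcases hUV (γ s) with h | h
        · exact ⟨true, by simpa⟩
        · exact ⟨false, by simpa⟩))
    have ind : ∀ m, ((c (γ (t 0))).trans (γ.subpath (t 0) (t m))).Homotopic (c (γ (t m))) := by
      intro m
      induction m with
      | zero =>
        rw [Path.subpath_self]
        exact ⟨Path.Homotopy.transRefl _⟩
      | succ m ih =>
        have h1 : ((γ.subpath (t 0) (t m)).trans (γ.subpath (t m) (t (m + 1)))).Homotopic
            (γ.subpath (t 0) (t (m + 1))) := ⟨Path.Homotopy.subpathTransSubpath _ _ _ _⟩
        have h2 : ((c (γ (t m))).trans (γ.subpath (t m) (t (m + 1)))).Homotopic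
            (c (γ (t (m + 1)))) := by
          apply small
          obtain ⟨b, hb⟩ := t_sub m
          have hr : ∀ s, γ.subpath (t m) (t (m + 1)) s ∈ if b then U else V := by
            intro s
            have : γ.subpath (t m) (t (m + 1)) s ∈ γ '' Set.Icc (t m) (t (m + 1)) := by
              rw [← Path.range_subpath_of_le _ _ _ (t_mono m.le_succ)]
              exact Set.mem_range_self s
            obtain ⟨r, hr, hr'⟩ := this
            rw [← hr']
            exact hb hr
          cases b
          · right; simpa using hr
          · left; simpa using hr
        refine ((Path.Homotopic.refl _).hcomp h1.symm).trans ?_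
        refine Path.Homotopic.trans ⟨(Path.Homotopy.transAssoc _ _ _).symm⟩ ?_
        exact (ih.hcomp (Path.Homotopic.refl _)).trans h2
    have h1 := ind n
    rw [hn n le_rfl, t_0, Path.subpath_zero_one] at h1
    have h3 : ∀ {x' y' : Z} (hx : x' = x) (hy : y' = y),
        ((c x').trans (γ.cast hx hy)).Homotopic (c y') → ((c x).trans γ).Homotopic (c y) := by
      rintro x' y' rfl rfl h
      exact h
    exact h3 γ.source γ.target h1
  rw [simply_connected_iff_paths_homotopic']
  refine ⟨⟨⟨x₀⟩, fun x y => ⟨(c x).symm.trans (c y)⟩⟩, fun {x y} p q => ?_⟩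
  have h : ((c x).trans p).Homotopic ((c x).trans q) := (key p).trans (key q).symm
  have cancel : ∀ r : Path x y, ((c x).symm.trans ((c x).trans r)).Homotopic r := fun r =>
    Path.Homotopic.trans ⟨(Path.Homotopy.transAssoc _ _ _).symm⟩
      (Path.Homotopic.trans (Path.Homotopic.hcomp ⟨(Path.Homotopy.reflSymmTrans _).symm⟩
        (Path.Homotopic.refl _)) ⟨Path.Homotopy.reflTrans _⟩)
  exact (cancel p).symm.trans (((Path.Homotopic.refl _).hcomp h).trans (cancel q))

end VanKampen

/-! ### `ℝ³ ∖ 0` is simply connected -/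

/-- The complement in `ℝ³` of the ray spanned by `ε e₃`. -/
def rayCompl (ε : ℝ) : Set XTilde := {x | ¬ (x.1 0 = 0 ∧ x.1 1 = 0 ∧ 0 ≤ ε * x.1 2)}

theorem isOpen_rayCompl (ε : ℝ) : IsOpen (rayCompl ε) := by
  have h : IsClosed {x : XTilde | x.1 0 = 0 ∧ x.1 1 = 0 ∧ 0 ≤ ε * x.1 2} := by
    have h0 : IsClosed {x : XTilde | x.1 0 = 0} := isClosed_eq (by fun_prop) continuous_const
    have h1 : IsClosed {x : XTilde | x.1 1 = 0} := isClosed_eq (by fun_prop) continuous_const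
    have h2 : IsClosed {x : XTilde | 0 ≤ ε * x.1 2} := isClosed_le continuous_const (by fun_prop)
    exact h0.inter (h1.inter h2)
  exact h.isOpen_compl

theorem ne_zero_iff_coords (x : R3) : x ≠ 0 ↔ ¬ (x 0 = 0 ∧ x 1 = 0 ∧ x 2 = 0) := by
  rw [not_iff_not]
  constructor
  · rintro rfl; simp
  · rintro ⟨h0, h1, h2⟩
    ext i
    fin_cases i <;> simpa

/-- The complement of a closed ray from the origin is star-shaped about the point `-ε e₃` on the
opposite ray, hence contractible. -/
theorem simplyConnectedSpace_rayCompl {ε : ℝ} (hε : ε ≠ 0) :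
    SimplyConnectedSpace (rayCompl ε) := by
  let p : R3 := EuclideanSpace.single 2 (-ε)
  let S : Set R3 := {x | ¬ (x 0 = 0 ∧ x 1 = 0 ∧ 0 ≤ ε * x 2)}
  have hS0 : ∀ x ∈ S, x ≠ 0 := by
    rintro x hx rfl
    exact hx (by simp)
  have hpS : p ∈ S := by
    have : 0 < ε ^ 2 := by positivity
    simp only [S, p, Set.mem_ofPred_eq, not_and, not_le]
    intro _ _
    simp
    nlinarith
  have hstar : StarConvex ℝ p S := by
    intro x hx a b ha hb hab
    simp only [S, Set.mem_ofPred_eq, not_and, not_le] at hx ⊢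
    have hε2 : 0 < ε ^ 2 := by positivity
    rcases hb.eq_or_lt with rfl | hb
    · obtain rfl : a = 1 := by linarith
      intro _ _
      simp [p]
      nlinarith
    · intro h0 h1
      simp [p] at h0 h1 ⊢
      have := hx (h0.resolve_left hb.ne') (h1.resolve_left hb.ne')
      nlinarith [mul_neg_of_pos_of_neg hb this, mul_nonneg ha hε2.le]
  have : ContractibleSpace S := hstar.contractibleSpace ⟨p, hpS⟩
  let e : S ≃ₜ rayCompl ε :=
    { toFun := fun x => ⟨⟨x.1, hS0 x.1 x.2⟩, x.2⟩
      invFun := fun x => ⟨x.1.1, x.2⟩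
      left_inv := fun _ => rfl
      right_inv := fun _ => rfl
      continuous_toFun := by fun_prop
      continuous_invFun := by fun_prop }
  have : ContractibleSpace (rayCompl ε) := e.symm.contractibleSpace
  infer_instance

/-- The two rays make up the whole third axis, the kernel of the projection `L` to the first two
coordinates; a subspace of codimension two does not disconnect. -/
theorem isPathConnected_inter_rayCompl : IsPathConnected (rayCompl 1 ∩ rayCompl (-1)) := by
  let L : R3 →ₗ[ℝ] (Fin 2 → ℝ) :=
    LinearMap.pi ![(EuclideanSpace.proj (𝕜 := ℝ) 0).toLinearMap,
      (EuclideanSpace.proj (𝕜 := ℝ) 1).toLinearMap]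
  have hL : ∀ x, x ∈ LinearMap.ker L ↔ x 0 = 0 ∧ x 1 = 0 := by
    intro x
    simp [L, LinearMap.mem_ker, funext_iff, Fin.forall_fin_two]
  have hsurj : Function.Surjective L := by
    intro v
    refine ⟨WithLp.toLp 2 ![v 0, v 1, 0], ?_⟩
    ext i
    fin_cases i <;> simp [L]
  have hpc : IsPathConnected ((LinearMap.ker L : Set R3)ᶜ) := by
    apply isPathConnected_compl_of_one_lt_codim
    rw [(L.quotKerEquivOfSurjective hsurj).rank_eq]
    simp
  have hne : ∀ x ∈ ((LinearMap.ker L : Set R3)ᶜ), x ≠ 0 := by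
    rintro x hx rfl
    exact hx (LinearMap.ker L).zero_mem
  have him : (rayCompl 1 ∩ rayCompl (-1)) = (Subtype.val : XTilde → R3) ⁻¹' (LinearMap.ker L : Set R3)ᶜ := by
    ext x
    simp only [rayCompl, Set.mem_inter_iff, Set.mem_ofPred_eq, Set.mem_preimage, Set.mem_compl_iff,
      SetLike.mem_coe, hL]
    constructor
    · rintro ⟨h1, h2⟩ ⟨h3, h4⟩
      rcases le_total 0 (x.1 2) with h | h
      · exact h1 ⟨h3, h4, by linarith⟩
      · exact h2 ⟨h3, h4, by linarith⟩
    · intro h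
      exact ⟨fun h' => h ⟨h'.1, h'.2.1⟩, fun h' => h ⟨h'.1, h'.2.1⟩⟩
  rw [him]
  refine hpc.preimage_coe ?_
  exact hne

instance : SimplyConnectedSpace XTilde := by
  have := simplyConnectedSpace_rayCompl (ε := 1) one_ne_zero
  have := simplyConnectedSpace_rayCompl (ε := -1) (by norm_num)
  refine simplyConnectedSpace_of_union (isOpen_rayCompl 1) (isOpen_rayCompl (-1)) ?_
    isPathConnected_inter_rayCompl
  intro x
  by_contra h
  push Not at h
  simp only [rayCompl, Set.mem_ofPred_eq, not_not] at h
  exact (ne_zero_iff_coords x.1).1 x.2 ⟨h.1.1, h.1.2.1, by linarith [h.1.2.2, h.2.2.2]⟩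

theorem isQuotientCoveringMap_coverX : IsQuotientCoveringMap coverX ℤˣ :=
  isQuotientCoveringMap_quotientMk_of_properlyDiscontinuousSMul (G := ℤˣ) (E := XTilde)

theorem isQuotientCoveringMap_mkM0 :
    IsQuotientCoveringMap (Quotient.mk _ : XTilde × Torus 3 → M0) ℤˣ :=
  isQuotientCoveringMap_quotientMk_of_properlyDiscontinuousSMul (G := ℤˣ) (E := XTilde × Torus 3)

/-- Over a simply connected total space the fundamental group is the opposite of the deck group. -/
theorem card_fundamentalGroup_X (b : X) : Nat.card (FundamentalGroup X b) = 2 := by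
  obtain ⟨x, hx⟩ := surjective_coverX b
  rw [Nat.card_congr (isQuotientCoveringMap_coverX.fundamentalGroupEquiv
    (⟨x, hx⟩ : coverX ⁻¹' {b})).toEquiv, Nat.card_congr MulOpposite.opEquiv.symm]
  simp

/-! ### `X` is homeomorphic to `ℝP² × ℝ` -/

section ProjectivePlane

/-- The saturation of an open set is a union of its preimages under scalings. Openness is needed
because, unlike being a quotient map, it passes to the product with `ℝ`. -/
theorem isOpenQuotientMap_projectivization :
    IsOpenQuotientMap (fun x : XTilde => Projectivization.mk ℝ x.1 x.2) := by
  have hq : Topology.IsQuotientMap (fun x : XTilde => Projectivization.mk ℝ x.1 x.2) :=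
    isQuotientMap_quotient_mk' (s := projectivizationSetoid ℝ R3)
  refine ⟨hq.surjective, hq.continuous, fun U hU => ?_⟩
  rw [← hq.isOpen_preimage]
  have h : (fun x : XTilde => Projectivization.mk ℝ x.1 x.2) ⁻¹'
      ((fun x : XTilde => Projectivization.mk ℝ x.1 x.2) '' U) =
      ⋃ c : ℝˣ, (fun x : XTilde => (⟨(c : ℝ) • x.1, smul_ne_zero c.ne_zero x.2⟩ : XTilde)) ⁻¹' U := by
    ext x
    simp only [Set.mem_preimage, Set.mem_image, Set.mem_iUnion]
    constructor
    · rintro ⟨y, hy, hxy⟩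
      obtain ⟨c, hc⟩ := (Projectivization.mk_eq_mk_iff ℝ _ _ y.2 x.2).1 hxy
      refine ⟨c, ?_⟩
      have hyx : (⟨(c : ℝ) • x.1, smul_ne_zero c.ne_zero x.2⟩ : XTilde) = y := Subtype.ext hc
      rwa [hyx]
    · rintro ⟨c, hc⟩
      exact ⟨_, hc, (Projectivization.mk_eq_mk_iff ℝ _ _ _ x.2).2 ⟨c, rfl⟩⟩
  rw [h]
  exact isOpen_iUnion fun c => hU.preimage (by fun_prop)

theorem coverX_eq_iff (x y : XTilde) : coverX x = coverX y ↔ x.1 = y.1 ∨ x.1 = -y.1 := by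
  rw [isQuotientCoveringMap_coverX.apply_eq_iff_mem_orbit, MulAction.mem_orbit_iff]
  constructor
  · rintro ⟨a, rfl⟩
    rcases Int.units_eq_one_or a with rfl | rfl
    · left; simp
    · right; simp [coe_smul]
  · rintro (h | h)
    · exact ⟨1, Subtype.ext (by simp [h])⟩
    · exact ⟨-1, Subtype.ext (by simp [h, coe_smul])⟩

/-- The map `[x] ↦ ([x], log ‖x‖)`. -/
noncomputable def toProj : X → ℙ ℝ R3 × ℝ :=
  Quotient.lift (fun x : XTilde => (Projectivization.mk ℝ x.1 x.2, Real.log ‖x.1‖)) (by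
    intro x y h
    have h' : coverX x = coverX y := Quotient.sound h
    rcases (coverX_eq_iff x y).1 h' with h | h
    · rw [Subtype.ext h]
    · refine Prod.ext ?_ (by simp [h])
      exact (Projectivization.mk_eq_mk_iff ℝ _ _ x.2 y.2).2 ⟨-1, by simp [h]⟩)

theorem toProj_coverX (x : XTilde) :
    toProj (coverX x) = (Projectivization.mk ℝ x.1 x.2, Real.log ‖x.1‖) := rfl

theorem log_norm_eq {x y : XTilde} (h : Real.log ‖x.1‖ = Real.log ‖y.1‖) : ‖x.1‖ = ‖y.1‖ :=
  Real.log_injOn_pos (norm_pos_iff.2 x.2) (norm_pos_iff.2 y.2) h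

/-- `(x, r) ↦ [eʳ x / ‖x‖]`. -/
noncomputable def scaleCover (p : XTilde × ℝ) : X :=
  coverX ⟨(Real.exp p.2 / ‖p.1.1‖) • p.1.1,
    smul_ne_zero (div_ne_zero (Real.exp_pos _).ne' (norm_ne_zero_iff.2 p.1.2)) p.1.2⟩

theorem toProj_scaleCover (p : XTilde × ℝ) :
    toProj (scaleCover p) = (Projectivization.mk ℝ p.1.1 p.1.2, p.2) := by
  have hn := norm_pos_iff.2 p.1.2
  rw [scaleCover, toProj_coverX]
  refine Prod.ext ?_ ?_
  · exact (Projectivization.mk_eq_mk_iff ℝ _ _ _ _).2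
      ⟨Units.mk0 _ (div_ne_zero (Real.exp_pos p.2).ne' hn.ne'), rfl⟩
  · simp only [norm_smul, norm_div, Real.norm_eq_abs, Real.abs_exp, abs_norm]
    rw [div_mul_cancel₀ _ hn.ne', Real.log_exp]

theorem toProj_injective : Function.Injective toProj := by
  intro a b h
  obtain ⟨x, rfl⟩ := surjective_coverX a
  obtain ⟨y, rfl⟩ := surjective_coverX b
  rw [toProj_coverX, toProj_coverX, Prod.mk.injEq] at h
  obtain ⟨c, hc⟩ := (Projectivization.mk_eq_mk_iff ℝ _ _ x.2 y.2).1 h.1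
  have hn := log_norm_eq h.2
  have hy := norm_pos_iff.2 y.2
  have hc' : (c : ℝ) • y.1 = x.1 := hc
  rw [← hc', norm_smul, mul_eq_right₀ hy.ne', Real.norm_eq_abs, abs_eq zero_le_one] at hn
  rw [coverX_eq_iff, ← hc']
  rcases hn with hn | hn <;> simp [hn]

theorem continuous_scaleCover : Continuous scaleCover := by
  have h : Continuous fun p : XTilde × ℝ => (Real.exp p.2 / ‖p.1.1‖) • p.1.1 :=
    Continuous.smul (Continuous.div (by fun_prop) (by fun_prop)
      fun p => norm_ne_zero_iff.2 p.1.2) (by fun_prop)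
  exact isQuotientCoveringMap_coverX.continuous.comp (h.subtype_mk _)

theorem continuous_toProj : Continuous toProj := by
  refine Continuous.quotient_lift ?_ _
  refine isOpenQuotientMap_projectivization.continuous.prodMk ?_
  exact Continuous.log (by fun_prop) fun x => norm_ne_zero_iff.2 x.2

theorem exists_homeomorph_projectivePlane :
    ∃ h : X ≃ₜ ℙ ℝ R3 × ℝ, ∀ x : XTilde,
      h (coverX x) = (Projectivization.mk ℝ x.1 x.2, Real.log ‖x.1‖) := by
  have hq : IsOpenQuotientMap
      (Prod.map (fun x : XTilde => Projectivization.mk ℝ x.1 x.2) (id : ℝ → ℝ)) :=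
    isOpenQuotientMap_projectivization.prodMap IsOpenQuotientMap.id
  have hopen : IsOpenMap toProj := by
    intro U hU
    -- `scaleCover` lifts the inverse of `toProj` through the open quotient map, so images of open
    -- sets become images of open preimages.
    have h : toProj '' U = Prod.map (fun x : XTilde => Projectivization.mk ℝ x.1 x.2) id ''
        (scaleCover ⁻¹' U) := by
      ext z
      constructor
      · rintro ⟨u, hu, rfl⟩
        obtain ⟨p, hp⟩ := hq.surjective (toProj u)
        have : toProj (scaleCover p) = toProj u := by rw [toProj_scaleCover, ← hp]; rfl
        exact ⟨p, by rwa [Set.mem_preimage, toProj_injective this], hp⟩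
      · rintro ⟨p, hp, rfl⟩
        exact ⟨_, hp, toProj_scaleCover p⟩
    rw [h]
    exact hq.isOpenMap _ (hU.preimage continuous_scaleCover)
  have hsurj : Function.Surjective toProj := by
    intro z
    obtain ⟨p, hp⟩ := hq.surjective z
    exact ⟨scaleCover p, by rw [toProj_scaleCover, ← hp]; rfl⟩
  exact ⟨(Equiv.ofBijective _ ⟨toProj_injective, hsurj⟩).toHomeomorphOfContinuousOpen
    continuous_toProj hopen, fun x => rfl⟩

end ProjectivePlane

/-! ### Manifolds whose transition maps are locally of the form `h ↦ ± h + k` -/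

section SignTransitions

variable (H Z : Type*) [NormedAddCommGroup H] [NormedSpace ℝ H] [TopologicalSpace Z]
  [ChartedSpace H Z]

/-- The transition maps of the atlas are locally of the form `h ↦ ± h + k`. -/
def HasSignTransitions : Prop :=
  ∀ c ∈ atlas H Z, ∀ c' ∈ atlas H Z, ∀ z, z ∈ c.source → z ∈ c'.source →
    ∃ (ε : ℝ) (k : H), (ε = 1 ∨ ε = -1) ∧ ∀ᶠ z' in 𝓝 z, c' z' = ε • c z' + k

variable {H Z}

theorem HasSignTransitions.isManifold (h : HasSignTransitions H Z) :
    IsManifold 𝓘(ℝ, H) ∞ Z := by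
  refine isManifold_of_contDiffOn _ _ _ fun c c' hc hc' => ?_
  simp only [modelWithCornersSelf_coe, modelWithCornersSelf_coe_symm, Set.preimage_id,
    Set.range_id, Set.inter_univ, Function.id_comp, Function.comp_id]
  intro y hy
  rw [OpenPartialHomeomorph.trans_source, OpenPartialHomeomorph.symm_source] at hy
  obtain ⟨ε, k, -, hε⟩ := h c hc c' hc' (c.symm y) (c.map_target hy.1) hy.2
  have hev : (c.symm.trans c' : H → H) =ᶠ[𝓝 y] fun y' => ε • y' + k := by
    filter_upwards [(c.continuousAt_symm hy.1).eventually hε, c.open_target.mem_nhds hy.1]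
      with y' h1 h2
    simp [h1, c.right_inv h2]
  refine ContDiffAt.contDiffWithinAt (ContDiffAt.congr_of_eventuallyEq ?_ hev)
  fun_prop

variable [IsManifold 𝓘(ℝ, H) ∞ Z]

theorem mdifferentiableAt_of_mem_atlas {c : OpenPartialHomeomorph Z H} (hc : c ∈ atlas H Z) {z : Z}
    (hz : z ∈ c.source) : MDifferentiableAt 𝓘(ℝ, H) 𝓘(ℝ, H) c z :=
  have : IsManifold 𝓘(ℝ, H) 1 Z := .of_le (n := ∞) (by simp)
  mdifferentiableAt_atlas hc hz

theorem mdifferentiable_of_mem_atlas' {c : OpenPartialHomeomorph Z H} (hc : c ∈ atlas H Z) :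
    c.MDifferentiable 𝓘(ℝ, H) 𝓘(ℝ, H) :=
  have : IsManifold 𝓘(ℝ, H) 1 Z := .of_le (n := ∞) (by simp)
  mdifferentiable_of_mem_atlas hc

/-- Only the sign of a transition survives differentiation. This serves twice: for the chart
independence of `omega0` and for the sign of the holonomy. -/
theorem mfderiv_chart_of_eventually {c c' : OpenPartialHomeomorph Z H} (hc : c ∈ atlas H Z)
    {z : Z} (hz : z ∈ c.source) {ε : ℝ} {k : H} (h : ∀ᶠ z' in 𝓝 z, c' z' = ε • c z' + k)
    (v : TangentSpace 𝓘(ℝ, H) z) :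
    (mfderiv 𝓘(ℝ, H) 𝓘(ℝ, H) c' z v : H) = ε • (mfderiv 𝓘(ℝ, H) 𝓘(ℝ, H) c z v : H) := by
  have h1 : HasFDerivAt (fun y : H => ε • y + k) (ε • ContinuousLinearMap.id ℝ H) (c z) :=
    ((hasFDerivAt_id (c z)).const_smul ε).add_const k
  have h2 := (mdifferentiableAt_of_mem_atlas hc hz).hasMFDerivAt
  have h3 := (h1.hasMFDerivAt.comp z h2).congr_of_eventuallyEq (f₁ := c') h
  rw [h3.mfderiv]
  rfl

/-- The chain rule for a chart composed with a map from a normed space. -/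
theorem mfderiv_chart_comp {E₀ : Type*} [NormedAddCommGroup E₀] [NormedSpace ℝ E₀]
    {c : OpenPartialHomeomorph Z H} (hc : c ∈ atlas H Z) {g : E₀ → Z} {p : E₀}
    (hp : g p ∈ c.source) (hg : MDifferentiableAt 𝓘(ℝ, E₀) 𝓘(ℝ, H) g p) (v : E₀) :
    (mfderiv 𝓘(ℝ, H) 𝓘(ℝ, H) c (g p) (mfderiv 𝓘(ℝ, E₀) 𝓘(ℝ, H) g p v) : H) =
      fderiv ℝ (c ∘ g) p v := by
  rw [← mfderiv_eq_fderiv, mfderiv_comp p (mdifferentiableAt_of_mem_atlas hc hp) hg]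
  rfl

theorem differentiableAt_chart_comp {E₀ : Type*} [NormedAddCommGroup E₀] [NormedSpace ℝ E₀]
    {c : OpenPartialHomeomorph Z H} (hc : c ∈ atlas H Z) {g : E₀ → Z} {p : E₀}
    (hp : g p ∈ c.source) (hg : MDifferentiableAt 𝓘(ℝ, E₀) 𝓘(ℝ, H) g p) :
    DifferentiableAt ℝ (c ∘ g) p :=
  ((mdifferentiableAt_of_mem_atlas hc hp).comp p hg).differentiableAt

end SignTransitions

/-! ### Charts of a manifold defined by a covering -/

section Cover

variable {H Y Z : Type*} [NormedAddCommGroup H] [NormedSpace ℝ H] [TopologicalSpace Y]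
    [TopologicalSpace Z] [Nonempty Y] {j : Y → H} (hj : Topology.IsOpenEmbedding j) {q : Y → Z}

/-- `T` is a map over the identity of `Z` that carries one inverse branch to the other at `z`. By
continuity it does so near `z`, since `T (e.symm z')` and `e'.symm z'` lie over the same point and
`q` is injective on `e'.source`. -/
theorem eventually_transition {e e' : OpenPartialHomeomorph Y Z} (he : ⇑e = q) (he' : ⇑e' = q)
    {T : Y → Y} (hT : Continuous T) (hqT : ∀ w, q (T w) = q w) {ε : ℝ} {k : H}
    (hjT : ∀ w, j (T w) = ε • j w + k) {z : Z} (hz : z ∈ e.target) (hz' : z ∈ e'.target)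
    (hTz : T (e.symm z) = e'.symm z) :
    ∀ᶠ z' in 𝓝 z, (e'.symm.trans (hj.toOpenPartialHomeomorph j)) z' =
      ε • (e.symm.trans (hj.toOpenPartialHomeomorph j)) z' + k := by
  have h1 : ContinuousAt (fun z' => T (e.symm z')) z :=
    hT.continuousAt.comp (e.continuousAt_symm hz)
  have h2 : ∀ᶠ z' in 𝓝 z, T (e.symm z') ∈ e'.source :=
    h1.eventually (e'.open_source.mem_nhds (hTz.symm ▸ e'.map_target hz' : T (e.symm z) ∈ e'.source))
  filter_upwards [h2, e.open_target.mem_nhds hz] with z' h3 h4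
  simp only [OpenPartialHomeomorph.coe_trans, Function.comp_apply,
    Topology.IsOpenEmbedding.toOpenPartialHomeomorph_apply]
  have h5 : e'.symm z' = T (e.symm z') := by
    conv_lhs => rw [← e.right_inv h4, he, ← hqT, ← he', e'.left_inv h3]
  rw [h5, hjT]

end Cover

theorem mem_atlas_X_iff (c : OpenPartialHomeomorph X R3) : c ∈ atlas R3 X ↔
    ∃ e : OpenPartialHomeomorph XTilde X, ⇑e = coverX ∧
      c = e.symm.trans (isOpenEmbedding_val.toOpenPartialHomeomorph Subtype.val) := Iff.rfl

theorem isOpenEmbedding_valProd :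
    Topology.IsOpenEmbedding (Prod.map Subtype.val id : XTilde × R3 → R3 × R3) :=
  isOpenEmbedding_val.prodMap Topology.IsOpenEmbedding.id

theorem mem_atlas_M0_iff (c : OpenPartialHomeomorph M0 (R3 × R3)) : c ∈ atlas (R3 × R3) M0 ↔
    ∃ e : OpenPartialHomeomorph (XTilde × R3) M0, ⇑e = coverM0 ∧
      c = e.symm.trans (isOpenEmbedding_valProd.toOpenPartialHomeomorph _) := Iff.rfl

theorem hasSignTransitions_X : HasSignTransitions R3 X := by
  intro c hc c' hc' z hz hz'
  obtain ⟨e, he, rfl⟩ := (mem_atlas_X_iff c).1 hc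
  obtain ⟨e', he', rfl⟩ := (mem_atlas_X_iff c').1 hc'
  simp only [OpenPartialHomeomorph.trans_source, OpenPartialHomeomorph.symm_source,
    Topology.IsOpenEmbedding.toOpenPartialHomeomorph_source, Set.preimage_univ,
    Set.inter_univ] at hz hz'
  have h : coverX (e'.symm z) = coverX (e.symm z) := by
    rw [← he', e'.right_inv hz', he', ← he, e.right_inv hz]
  obtain ⟨a, ha⟩ := (isQuotientCoveringMap_coverX.apply_eq_iff_mem_orbit).1 h
  refine ⟨((a : ℤ) : ℝ), 0, ?_, eventually_transition _ he he' (T := fun w => a • w)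
    (continuous_const_smul a) (fun w => isQuotientCoveringMap_coverX.map_smul a) ?_ hz hz' ha⟩
  · rcases Int.units_eq_one_or a with rfl | rfl <;> simp
  · intro w
    rcases Int.units_eq_one_or a with rfl | rfl <;> simp [coe_smul]

theorem toTorus_add {n : ℕ} (s t : EuclideanSpace ℝ (Fin n)) :
    toTorus (s + t) = toTorus s + toTorus t := by
  ext i; simp [toTorus]

theorem toTorus_neg {n : ℕ} (s : EuclideanSpace ℝ (Fin n)) : toTorus (-s) = -toTorus s := by
  ext i; simp [toTorus]

theorem toTorus_sub {n : ℕ} (s t : EuclideanSpace ℝ (Fin n)) :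
    toTorus (s - t) = toTorus s - toTorus t := by
  ext i; simp [toTorus]

theorem hasSignTransitions_M0 : HasSignTransitions (R3 × R3) M0 := by
  intro c hc c' hc' z hz hz'
  obtain ⟨e, he, rfl⟩ := (mem_atlas_M0_iff c).1 hc
  obtain ⟨e', he', rfl⟩ := (mem_atlas_M0_iff c').1 hc'
  simp only [OpenPartialHomeomorph.trans_source, OpenPartialHomeomorph.symm_source,
    Topology.IsOpenEmbedding.toOpenPartialHomeomorph_source, Set.preimage_univ,
    Set.inter_univ] at hz hz'
  have h : coverM0 (e'.symm z) = coverM0 (e.symm z) := by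
    rw [← he', e'.right_inv hz', he', ← he, e.right_inv hz]
  obtain ⟨a, ha⟩ := (isQuotientCoveringMap_mkM0.apply_eq_iff_mem_orbit).1 h
  have ha1 : a • (e.symm z).1 = (e'.symm z).1 := congrArg Prod.fst ha
  have ha2 : a • toTorus (e.symm z).2 = toTorus (e'.symm z).2 := congrArg Prod.snd ha
  -- Two lifts of a point of `M0` differ by a deck sign and, in the angle, by a vector of the
  -- lattice `ℤ³`; `k` is that vector.
  let k : R3 := (e'.symm z).2 - a • (e.symm z).2
  have hsm : ∀ s : R3, toTorus (a • s) = a • toTorus s := by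
    intro s
    rcases Int.units_eq_one_or a with rfl | rfl
    · simp
    · simp [toTorus_neg]
  have hk : toTorus k = 0 := by
    rw [toTorus_sub, hsm, ha2, sub_self]
  refine ⟨((a : ℤ) : ℝ), (0, k), ?_, eventually_transition _ he he'
    (T := fun w => (a • w.1, a • w.2 + k))
    ?_ ?_ ?_ hz hz' ?_⟩
  · rcases Int.units_eq_one_or a with rfl | rfl <;> simp
  · refine ((continuous_const_smul a).comp continuous_fst).prodMk (Continuous.add ?_ continuous_const)
    rcases Int.units_eq_one_or a with rfl | rfl
    · simpa using continuous_snd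
    · simpa using! continuous_snd.neg
  · intro w
    refine isQuotientCoveringMap_mkM0.apply_eq_iff_mem_orbit.2 ⟨a, ?_⟩
    refine Prod.ext rfl ?_
    change a • toTorus w.2 = toTorus (a • w.2 + k)
    rw [toTorus_add, hk, add_zero, hsm]
  · intro w
    rcases Int.units_eq_one_or a with rfl | rfl <;> refine Prod.ext ?_ ?_ <;> simp [coe_smul]
  · exact Prod.ext ha1 (by simp [k])

instance : IsManifold 𝓘(ℝ, R3) ∞ X := hasSignTransitions_X.isManifold

instance : IsManifold 𝓘(ℝ, R3 × R3) ∞ M0 := hasSignTransitions_M0.isManifold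

/-! ### The symplectic form -/

theorem stdForm_smul {n : ℕ} {ε : ℝ} (hε : ε = 1 ∨ ε = -1)
    (v w : EuclideanSpace ℝ (Fin n) × EuclideanSpace ℝ (Fin n)) :
    stdForm (ε • v) (ε • w) = stdForm v w := by
  rcases hε with rfl | rfl <;> simp [stdForm]

/-- Independence of the chart: a transition multiplies both arguments of the bilinear form by the
same sign. -/
theorem omega0_eq {c : OpenPartialHomeomorph M0 (R3 × R3)} (hc : c ∈ atlas (R3 × R3) M0) {m : M0}
    (hm : m ∈ c.source) (v w : TangentSpace 𝓘(ℝ, R3 × R3) m) :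
    omega0 m v w = stdForm (n := 3) (mfderiv 𝓘(ℝ, R3 × R3) 𝓘(ℝ, R3 × R3) c m v)
      (mfderiv 𝓘(ℝ, R3 × R3) 𝓘(ℝ, R3 × R3) c m w) := by
  obtain ⟨ε, k, hε, h⟩ := hasSignTransitions_M0 _ (chart_mem_atlas (R3 × R3) m) c hc m
    (mem_chart_source _ m) hm
  have h1 := mfderiv_chart_of_eventually (chart_mem_atlas (R3 × R3) m) (mem_chart_source _ m) h
  exact ((congrArg₂ (stdForm (n := 3)) (h1 v) (h1 w)).trans (stdForm_smul hε _ _)).symm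

theorem stdForm_add_left {n : ℕ} (u v w : EuclideanSpace ℝ (Fin n) × EuclideanSpace ℝ (Fin n)) :
    stdForm (u + v) w = stdForm u w + stdForm v w := by
  simp only [stdForm, ← Finset.sum_add_distrib, Prod.fst_add, Prod.snd_add, PiLp.add_apply]
  exact Finset.sum_congr rfl fun i _ => by ring

theorem stdForm_smul_left {n : ℕ} (r : ℝ) (v w : EuclideanSpace ℝ (Fin n) × EuclideanSpace ℝ (Fin n)) :
    stdForm (r • v) w = r * stdForm v w := by
  simp only [stdForm, Finset.mul_sum, Prod.smul_fst, Prod.smul_snd, PiLp.smul_apply, smul_eq_mul]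
  exact Finset.sum_congr rfl fun i _ => by ring

theorem stdForm_skew {n : ℕ} (v w : EuclideanSpace ℝ (Fin n) × EuclideanSpace ℝ (Fin n)) :
    stdForm v w = -stdForm w v := by
  simp only [stdForm, ← Finset.sum_neg_distrib]
  exact Finset.sum_congr rfl fun i _ => by ring

theorem eq_zero_of_stdForm {n : ℕ} (v : EuclideanSpace ℝ (Fin n) × EuclideanSpace ℝ (Fin n))
    (h : ∀ w, stdForm v w = 0) : v = 0 := by
  -- Pairing with the rotated vector gives the sum of squares of all coordinates of `v`.
  have h1 := h (-v.2, v.1)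
  simp only [stdForm, PiLp.neg_apply, mul_neg, sub_neg_eq_add] at h1
  rw [Finset.sum_eq_zero_iff_of_nonneg fun i _ => add_nonneg (mul_self_nonneg _) (mul_self_nonneg _)]
    at h1
  refine Prod.ext ?_ ?_ <;> ext i
  · have := h1 i (Finset.mem_univ i)
    simp only [Prod.fst_zero, PiLp.zero_apply]
    nlinarith [mul_self_nonneg (v.1 i), mul_self_nonneg (v.2 i)]
  · have := h1 i (Finset.mem_univ i)
    simp only [Prod.snd_zero, PiLp.zero_apply]
    nlinarith [mul_self_nonneg (v.1 i), mul_self_nonneg (v.2 i)]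

/-- The coefficients are constant in every chart, which gives both smoothness and closedness. -/
theorem formInChart_omega0 (c : M0) (u v y : R3 × R3) (hy : y ∈ (chartAt (R3 × R3) c).target) :
    formInChart omega0 c u v y = stdForm (n := 3) u v := by
  have hc := chart_mem_atlas (R3 × R3) c
  have h := (mdifferentiable_of_mem_atlas' hc).comp_symm_deriv hy
  rw [formInChart, omega0_eq hc ((chartAt (R3 × R3) c).map_target hy)]
  exact congrArg₂ (stdForm (n := 3)) (DFunLike.congr_fun h u) (DFunLike.congr_fun h v)

theorem isSymplecticForm_omega0 : IsSymplecticForm omega0 where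
  add_left m u v w := by
    simp only [omega0, map_add]
    exact stdForm_add_left _ _ _
  smul_left m r u v := by
    simp only [omega0, map_smul]
    exact stdForm_smul_left _ _ _
  skew m u v := stdForm_skew _ _
  nondegenerate m u h := by
    have hb := (mdifferentiable_of_mem_atlas' (chart_mem_atlas (R3 × R3) m)).mfderiv_bijective
      (mem_chart_source _ m)
    refine hb.1 ((eq_zero_of_stdForm _ fun w => ?_).trans (map_zero _).symm)
    obtain ⟨v, rfl⟩ := hb.2 w
    exact h v
  smooth c u v := contDiffOn_const.congr fun y hy => formInChart_omega0 c u v y hy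
  closed c y u v w hy := by
    have h : ∀ a b : R3 × R3, fderiv ℝ (formInChart omega0 c a b) y = 0 := by
      intro a b
      have : formInChart omega0 c a b =ᶠ[𝓝 y] fun _ => stdForm (n := 3) a b := by
        filter_upwards [(chartAt (R3 × R3) c).open_target.mem_nhds hy] with y' hy'
        exact formInChart_omega0 c a b y' hy'
      rw [this.fderiv_eq]
      simp
    simp [h]

/-! ### Charts through a given point of the covering -/

theorem exists_chart_X (y : XTilde) : ∃ c ∈ atlas R3 X, coverX y ∈ c.source ∧
    (∀ᶠ w in 𝓝 y, c (coverX w) = w.1) ∧ ∀ z ∈ c.source, ∃ w : XTilde, coverX w = z ∧ c z = w.1 := by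
  obtain ⟨e, hy, he⟩ := isLocalHomeomorph_coverX y
  refine ⟨_, (mem_atlas_X_iff _).2 ⟨e, he.symm, rfl⟩, ?_, ?_, ?_⟩
  · simpa [he] using e.map_source hy
  · filter_upwards [e.open_source.mem_nhds hy] with w hw
    simp [he, e.left_inv hw]
  · intro z hz
    simp only [OpenPartialHomeomorph.trans_source, OpenPartialHomeomorph.symm_source,
      Topology.IsOpenEmbedding.toOpenPartialHomeomorph_source, Set.preimage_univ,
      Set.inter_univ] at hz
    exact ⟨e.symm z, by rw [he, e.right_inv hz], by simp⟩

/-- The last clause holds on the whole source, not only near the given point: every chart value is a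
lift, so a point can be recovered from its coordinates. -/
theorem exists_chart_M0 (y : XTilde × R3) : ∃ c ∈ atlas (R3 × R3) M0, coverM0 y ∈ c.source ∧
    (∀ᶠ w in 𝓝 y, c (coverM0 w) = (w.1.1, w.2)) ∧
    ∀ z ∈ c.source, ∃ w : XTilde × R3, coverM0 w = z ∧ c z = (w.1.1, w.2) := by
  obtain ⟨e, hy, he⟩ := isLocalHomeomorph_coverM0 y
  refine ⟨_, (mem_atlas_M0_iff _).2 ⟨e, he.symm, rfl⟩, ?_, ?_, ?_⟩
  · simpa [he] using e.map_source hy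
  · filter_upwards [e.open_source.mem_nhds hy] with w hw
    simp [he, e.left_inv hw]
    rfl
  · intro z hz
    simp only [OpenPartialHomeomorph.trans_source, OpenPartialHomeomorph.symm_source,
      Topology.IsOpenEmbedding.toOpenPartialHomeomorph_source, Set.preimage_univ,
      Set.inter_univ] at hz
    exact ⟨e.symm z, by rw [he, e.right_inv hz], rfl⟩

theorem proj0_mk (p : XTilde × Torus 3) : proj0 ⟦p⟧ = coverX p.1 := rfl

theorem continuous_coverX : Continuous coverX := isQuotientCoveringMap_coverX.continuous

theorem continuous_coverM0 : Continuous coverM0 := isLocalHomeomorph_coverM0.continuous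

theorem continuous_proj0 : Continuous proj0 :=
  (continuous_coverX.comp continuous_fst).quotient_lift _

theorem eventually_chart_proj0 {y : XTilde × R3} {c : OpenPartialHomeomorph M0 (R3 × R3)}
    {c' : OpenPartialHomeomorph X R3} (hm : coverM0 y ∈ c.source)
    (h1 : ∀ᶠ w in 𝓝 y, c (coverM0 w) = (w.1.1, w.2))
    (h2 : ∀ z ∈ c.source, ∃ w : XTilde × R3, coverM0 w = z ∧ c z = (w.1.1, w.2))
    (h1' : ∀ᶠ w in 𝓝 y.1, c' (coverX w) = w.1) :
    ∀ᶠ m in 𝓝 (coverM0 y), c' (proj0 m) = (c m).1 := by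
  have hy : c (coverM0 y) = (y.1.1, y.2) := h1.self_of_nhds
  have h3 : ∀ᶠ p in 𝓝 ((y.1.1, y.2) : R3 × R3), ∀ w : XTilde × R3, (w.1.1, w.2) = p →
      c' (coverX w.1) = w.1.1 := by
    have h4 : ∀ᶠ x in 𝓝 y.1.1, ∀ w : XTilde, w.1 = x → c' (coverX w) = w.1 := by
      rw [← isOpenEmbedding_val.map_nhds_eq, Filter.eventually_map]
      filter_upwards [h1'] with x hx w hw
      rwa [Subtype.ext hw]
    filter_upwards [continuousAt_fst.eventually h4] with p hp w hw
    exact hp w.1 (congrArg Prod.fst hw)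
  rw [← hy] at h3
  filter_upwards [(c.continuousAt hm).eventually h3, c.open_source.mem_nhds hm] with m h5 h6
  obtain ⟨w, rfl, hw⟩ := h2 m h6
  rw [hw]
  exact h5 w hw.symm

/-- In suitable charts at `m` and at `proj0 m`, the map `proj0` is the first projection. -/
theorem exists_charts_proj0 (m : M0) : ∃ c ∈ atlas (R3 × R3) M0, ∃ c' ∈ atlas R3 X,
    m ∈ c.source ∧ proj0 m ∈ c'.source ∧ ∀ᶠ m' in 𝓝 m, c' (proj0 m') = (c m').1 := by
  obtain ⟨y, rfl⟩ := surjective_coverM0 m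
  obtain ⟨c, hc, hm, h1, h2⟩ := exists_chart_M0 y
  obtain ⟨c', hc', hm', h1', -⟩ := exists_chart_X y.1
  exact ⟨c, hc, c', hc', hm, hm', eventually_chart_proj0 hm h1 h2 h1'⟩

theorem contMDiff_proj0 : ContMDiff 𝓘(ℝ, R3 × R3) 𝓘(ℝ, R3) ∞ proj0 := by
  intro m
  obtain ⟨c, hc, c', hc', hm, hm', h⟩ := exists_charts_proj0 m
  have h1 : ContMDiffAt 𝓘(ℝ, R3 × R3) 𝓘(ℝ, R3 × R3) ∞ c m :=
    contMDiffAt_of_mem_maximalAtlas (IsManifold.subset_maximalAtlas hc) hm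
  have h2 : ContMDiffAt 𝓘(ℝ, R3) 𝓘(ℝ, R3) ∞ c'.symm (c m).1 :=
    contMDiffAt_symm_of_mem_maximalAtlas (IsManifold.subset_maximalAtlas hc')
      (h.self_of_nhds ▸ c'.map_source hm')
  have h3 : ContMDiffAt 𝓘(ℝ, R3 × R3) 𝓘(ℝ, R3) ∞ (fun m' => c'.symm (c m').1) m :=
    h2.comp m (ContMDiffAt.comp (g := Prod.fst) m
      (contDiff_fst (𝕜 := ℝ) (E := R3) (F := R3)).contMDiff.contMDiffAt h1)
  refine h3.congr_of_eventuallyEq ?_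
  filter_upwards [h, continuous_proj0.continuousAt.eventually (c'.open_source.mem_nhds hm')]
    with m' h4 h5
  rw [← h4, c'.left_inv h5]

theorem mdifferentiableAt_proj0 (m : M0) :
    MDifferentiableAt 𝓘(ℝ, R3 × R3) 𝓘(ℝ, R3) proj0 m :=
  contMDiff_proj0.contMDiffAt.mdifferentiableAt (by simp)

theorem mfderiv_proj0 {m : M0} {c : OpenPartialHomeomorph M0 (R3 × R3)} {c' : OpenPartialHomeomorph X R3}
    (hc : c ∈ atlas (R3 × R3) M0) (hc' : c' ∈ atlas R3 X) (hm : m ∈ c.source)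
    (hm' : proj0 m ∈ c'.source) (h : ∀ᶠ m' in 𝓝 m, c' (proj0 m') = (c m').1)
    (v : TangentSpace 𝓘(ℝ, R3 × R3) m) :
    mfderiv 𝓘(ℝ, R3) 𝓘(ℝ, R3) c' (proj0 m) (mfderiv 𝓘(ℝ, R3 × R3) 𝓘(ℝ, R3) proj0 m v) =
      (mfderiv 𝓘(ℝ, R3 × R3) 𝓘(ℝ, R3 × R3) c m v : R3 × R3).1 := by
  have h1 : mfderiv 𝓘(ℝ, R3 × R3) 𝓘(ℝ, R3) (c' ∘ proj0) m =
      mfderiv 𝓘(ℝ, R3 × R3) 𝓘(ℝ, R3) (Prod.fst ∘ c) m := Filter.EventuallyEq.mfderiv_eq h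
  rw [mfderiv_comp m (mdifferentiableAt_of_mem_atlas hc' hm') (mdifferentiableAt_proj0 m)] at h1
  have h2 := (hasFDerivAt_fst (𝕜 := ℝ) (p := c m)).hasMFDerivAt.comp m
    (mdifferentiableAt_of_mem_atlas hc hm).hasMFDerivAt
  rw [h2.mfderiv] at h1
  exact DFunLike.congr_fun h1 v

theorem surjective_mfderiv_proj0 (m : M0) :
    Function.Surjective (mfderiv 𝓘(ℝ, R3 × R3) 𝓘(ℝ, R3) proj0 m) := by
  obtain ⟨c, hc, c', hc', hm, hm', h⟩ := exists_charts_proj0 m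
  intro u
  obtain ⟨v, hv⟩ := ((mdifferentiable_of_mem_atlas' hc).mfderiv_bijective hm).2
    ((mfderiv 𝓘(ℝ, R3) 𝓘(ℝ, R3) c' (proj0 m) u, 0) : R3 × R3)
  refine ⟨v, ((mdifferentiable_of_mem_atlas' hc').mfderiv_bijective hm').1 ?_⟩
  rw [mfderiv_proj0 hc hc' hm hm' h]
  exact congrArg Prod.fst hv

theorem omega0_eq_zero_of_vertical (m : M0) (u v : TangentSpace 𝓘(ℝ, R3 × R3) m)
    (hu : mfderiv 𝓘(ℝ, R3 × R3) 𝓘(ℝ, R3) proj0 m u = 0)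
    (hv : mfderiv 𝓘(ℝ, R3 × R3) 𝓘(ℝ, R3) proj0 m v = 0) : omega0 m u v = 0 := by
  obtain ⟨c, hc, c', hc', hm, hm', h⟩ := exists_charts_proj0 m
  have hu' := mfderiv_proj0 hc hc' hm hm' h u
  have hv' := mfderiv_proj0 hc hc' hm hm' h v
  rw [hu, map_zero] at hu'
  rw [hv, map_zero] at hv'
  rw [omega0_eq hc hm]
  unfold stdForm
  refine Finset.sum_eq_zero fun i _ => ?_
  rw [← hu', ← hv']
  change (0 : ℝ) * _ - _ * (0 : ℝ) = 0
  ring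

theorem omega0_mfderiv {c : OpenPartialHomeomorph M0 (R3 × R3)} (hc : c ∈ atlas (R3 × R3) M0)
    {g : R3 × R3 → M0} {p : R3 × R3} (hp : g p ∈ c.source)
    (hg : MDifferentiableAt 𝓘(ℝ, R3 × R3) 𝓘(ℝ, R3 × R3) g p) (v w : R3 × R3) :
    omega0 (g p) (mfderiv 𝓘(ℝ, R3 × R3) 𝓘(ℝ, R3 × R3) g p v)
      (mfderiv 𝓘(ℝ, R3 × R3) 𝓘(ℝ, R3 × R3) g p w) =
    stdForm (n := 3) (fderiv ℝ (c ∘ g) p v) (fderiv ℝ (c ∘ g) p w) := by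
  rw [omega0_eq hc hp]
  exact congrArg₂ (stdForm (n := 3)) (mfderiv_chart_comp hc hp hg v) (mfderiv_chart_comp hc hp hg w)

/-! ### The standard action-angle coordinates -/

section Standard

variable (e : OpenPartialHomeomorph XTilde X) (he : ⇑e = coverX)

theorem injOn_mk_of_section (he : ⇑e = coverX) :
    Set.InjOn (Quotient.mk _ : XTilde × Torus 3 → M0) (e.source ×ˢ Set.univ) := by
  intro p hp p' hp' h
  have h1 : coverX p.1 = coverX p'.1 := congrArg proj0 h
  have h2 : p.1 = p'.1 := e.injOn hp.1 hp'.1 (by rwa [he])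
  obtain ⟨a, ha⟩ := isQuotientCoveringMap_mkM0.apply_eq_iff_mem_orbit.1 h
  have ha1 : a • p'.1 = p.1 := congrArg Prod.fst ha
  obtain rfl := units_eq_one_of_smul_eq a p'.1 (ha1.trans h2)
  simpa using ha.symm

theorem isLocalHomeomorph_mkM0 : IsLocalHomeomorph (Quotient.mk _ : XTilde × Torus 3 → M0) :=
  isQuotientCoveringMap_mkM0.isCoveringMap.isLocalHomeomorph

/-- The restriction of `(x, t) ↦ [x, t]` to the domain of a local inverse of `ℝ³ ∖ 0 → X`. -/
noncomputable def mkOn (he : ⇑e = coverX) : OpenPartialHomeomorph (XTilde × Torus 3) M0 :=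
  .ofContinuousOpen (injOn_mk_of_section e he).bijOn_image.toPartialEquiv
    isQuotientCoveringMap_mkM0.continuous.continuousOn isLocalHomeomorph_mkM0.isOpenMap
    (e.open_source.prod isOpen_univ)

theorem mkOn_source : (mkOn e he).source = e.source ×ˢ Set.univ := rfl

theorem mkOn_symm_mk {p : XTilde × Torus 3} (hp : p.1 ∈ e.source) : (mkOn e he).symm ⟦p⟧ = p :=
  (mkOn e he).left_inv (x := p) ⟨hp, trivial⟩

theorem mem_mkOn_target (m : M0) : m ∈ (mkOn e he).target ↔ proj0 m ∈ e.target := by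
  constructor
  · rintro ⟨p, hp, rfl⟩
    rw [proj0_mk, ← he]
    exact e.map_source hp.1
  · intro h
    obtain ⟨p, rfl⟩ := Quotient.exists_rep m
    have h1 : coverX (e.symm (proj0 ⟦p⟧)) = coverX p.1 := by
      rw [← proj0_mk, ← he, e.right_inv h]
    obtain ⟨a, ha⟩ := isQuotientCoveringMap_coverX.apply_eq_iff_mem_orbit.1 h1
    refine ⟨a • p, ⟨?_, trivial⟩, isQuotientCoveringMap_mkM0.map_smul a⟩
    change a • p.1 = _ at ha
    change a • p.1 ∈ _
    rw [ha]
    exact e.map_target h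

/-- The trivialisation of `M₀ → X` defined by a local inverse of `ℝ³ ∖ 0 → X`. -/
noncomputable def stdTriv : Bundle.Trivialization (Torus 3) proj0 where
  toOpenPartialHomeomorph :=
    ((e.symm.prod (OpenPartialHomeomorph.refl (Torus 3))).trans (mkOn e he)).symm
  baseSet := e.target
  open_baseSet := e.open_target
  source_eq := by
    have h : (mkOn e he).target ∩ (mkOn e he).symm ⁻¹' (e.source ×ˢ Set.univ) =
        (mkOn e he).target := Set.inter_eq_left.2 fun m hm => (mkOn e he).map_target hm
    ext m
    simpa [OpenPartialHomeomorph.trans_target, h] using mem_mkOn_target e he m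
  target_eq := by
    ext p
    simp [mkOn_source]
    exact fun h => e.map_target h
  proj_toFun m hm := by
    have hm' : m ∈ (mkOn e he).target := by
      simp at hm
      exact hm.1
    obtain ⟨p, hp, rfl⟩ := hm'
    change e ((mkOn e he).symm ⟦p⟧).1 = coverX p.1
    rw [mkOn_symm_mk e he hp.1, he]

theorem stdTriv_symm_apply (b : X) (t : Torus 3) :
    (stdTriv e he).toOpenPartialHomeomorph.symm (b, t) = ⟦(e.symm b, t)⟧ := rfl

/-- The action coordinates given by a local inverse of `ℝ³ ∖ 0 → X`. -/
noncomputable def stdAction : OpenPartialHomeomorph X R3 :=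
  e.symm.trans (isOpenEmbedding_val.toOpenPartialHomeomorph Subtype.val)

include he in
theorem stdAction_mem_atlas : stdAction e ∈ atlas R3 X := ⟨e, he, rfl⟩

theorem stdAction_source : (stdAction e).source = e.target := by
  simp [stdAction]

theorem stdAction_apply (b : X) : stdAction e b = (e.symm b).1 := by
  simp [stdAction]

theorem mem_stdAction_target (x : R3) :
    x ∈ (stdAction e).target ↔ ∃ h : x ≠ 0, (⟨x, h⟩ : XTilde) ∈ e.source := by
  simp only [stdAction, OpenPartialHomeomorph.trans_target, OpenPartialHomeomorph.symm_target,
    Topology.IsOpenEmbedding.toOpenPartialHomeomorph_target, Set.mem_inter_iff, Set.mem_preimage]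
  constructor
  · rintro ⟨⟨y, rfl⟩, hy⟩
    rw [Topology.IsOpenEmbedding.toOpenPartialHomeomorph_left_inv] at hy
    exact ⟨y.2, hy⟩
  · rintro ⟨h, hx⟩
    refine ⟨⟨⟨x, h⟩, rfl⟩, ?_⟩
    have := isOpenEmbedding_val.toOpenPartialHomeomorph_left_inv (x := (⟨x, h⟩ : XTilde))
    rwa [this]

theorem stdAction_symm_apply (he : ⇑e = coverX) (x : R3) (h : x ≠ 0) :
    (stdAction e).symm x = coverX ⟨x, h⟩ := by
  have := isOpenEmbedding_val.toOpenPartialHomeomorph_left_inv (x := (⟨x, h⟩ : XTilde))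
  simp only [stdAction, OpenPartialHomeomorph.trans_symm_eq_symm_trans_symm,
    OpenPartialHomeomorph.symm_symm, OpenPartialHomeomorph.coe_trans, Function.comp_apply, he]
  rw [this]

theorem std_param_eq (y : R3 × R3) (hy : y.1 ∈ (stdAction e).target) :
    ∃ h : y.1 ≠ 0, (stdTriv e he).toOpenPartialHomeomorph.symm
      ((stdAction e).symm y.1, toTorus y.2) = coverM0 (⟨y.1, h⟩, y.2) := by
  obtain ⟨h, hs⟩ := (mem_stdAction_target e y.1).1 hy
  refine ⟨h, ?_⟩
  rw [stdTriv_symm_apply, stdAction_symm_apply e he y.1 h, ← he, e.left_inv hs]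
  rfl

/-- Near a point, the standard parametrisation is the inverse of a chart. -/
theorem exists_chart_std_param (y : R3 × R3) (hy : y.1 ∈ (stdAction e).target) :
    ∃ c ∈ atlas (R3 × R3) M0, y ∈ c.target ∧
      (fun y : R3 × R3 => (stdTriv e he).toOpenPartialHomeomorph.symm
        ((stdAction e).symm y.1, toTorus y.2)) =ᶠ[𝓝 y] c.symm := by
  obtain ⟨h, hy'⟩ := std_param_eq e he y hy
  obtain ⟨c, hc, hm, h1, -⟩ := exists_chart_M0 (⟨y.1, h⟩, y.2)
  have hcy : c (coverM0 (⟨y.1, h⟩, y.2)) = y := h1.self_of_nhds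
  refine ⟨c, hc, hcy ▸ c.map_source hm, ?_⟩
  have h2 := h1.and (continuous_coverM0.continuousAt.eventually (c.open_source.mem_nhds hm))
  have h3 : ∀ᶠ p in 𝓝 y, ∀ w : XTilde × R3, (w.1.1, w.2) = p → coverM0 w = c.symm p := by
    have hj := isOpenEmbedding_valProd.map_nhds_eq ((⟨y.1, h⟩, y.2) : XTilde × R3)
    change _ = 𝓝 y at hj
    rw [← hj, Filter.eventually_map]
    filter_upwards [h2] with w hw w' hw'
    obtain rfl : w' = w := isOpenEmbedding_valProd.injective hw'
    change _ = c.symm (w'.1.1, w'.2)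
    rw [← hw.1, c.left_inv hw.2]
  have h4 : ∀ᶠ p in 𝓝 y, p.1 ∈ (stdAction e).target :=
    continuousAt_fst.eventually ((stdAction e).open_target.mem_nhds hy)
  filter_upwards [h3, h4] with p hp3 hp4
  obtain ⟨hp, hp'⟩ := std_param_eq e he p hp4
  rw [hp']
  exact hp3 _ rfl

/-- The standard action-angle coordinates. -/
noncomputable def stdChart : ActionAngleChart R3 3 omega0 proj0 where
  action := stdAction e
  triv := stdTriv e he
  baseSet_eq := (stdAction_source e).symm
  smooth_action :=
    contMDiffOn_of_mem_maximalAtlas (IsManifold.subset_maximalAtlas (stdAction_mem_atlas e he))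
  smooth_action_symm :=
    contMDiffOn_symm_of_mem_maximalAtlas (IsManifold.subset_maximalAtlas (stdAction_mem_atlas e he))
  smooth_param := by
    rintro y ⟨hy, -⟩
    obtain ⟨c, hc, hyc, h⟩ := exists_chart_std_param e he y hy
    have h1 : ContMDiffAt 𝓘(ℝ, R3 × R3) 𝓘(ℝ, R3 × R3) ∞ c.symm y :=
      contMDiffAt_symm_of_mem_maximalAtlas (IsManifold.subset_maximalAtlas hc) hyc
    exact (h1.congr_of_eventuallyEq h).contMDiffWithinAt
  symplectic := by
    intro y v w hy
    obtain ⟨c, hc, hyc, h⟩ := exists_chart_std_param e he y hy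
    have hg := (((mdifferentiable_of_mem_atlas' hc).mdifferentiableAt_symm hyc).congr_of_eventuallyEq h)
    -- In the chart `c` the parametrisation is the identity, so the pulled-back form is `stdForm`
    -- itself.
    have hcg : (c ∘ fun y : R3 × R3 => (stdTriv e he).toOpenPartialHomeomorph.symm
        ((stdAction e).symm y.1, toTorus y.2)) =ᶠ[𝓝 y] id := by
      filter_upwards [h, c.open_target.mem_nhds hyc] with p hp hp'
      rw [Function.comp_apply, hp, c.right_inv hp', id]
    have hy' : (stdTriv e he).toOpenPartialHomeomorph.symm
        ((stdAction e).symm y.1, toTorus y.2) ∈ c.source := by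
      rw [h.eq_of_nhds]
      exact c.map_target hyc
    have h3 := omega0_mfderiv hc hy' hg v w
    rwa [hcg.fderiv_eq, fderiv_id] at h3

end Standard

theorem isLagrangianFibration_proj0 :
    IsLagrangianFibration R3 3 (Torus 3) omega0 proj0 where
  manifold_total := inferInstance
  t2_total := t2Space_of_properlyDiscontinuousSMul_of_t2Space
  countable_total := ContinuousConstSMul.secondCountableTopology
  dim_total := by simp
  finite_total := inferInstance
  manifold_base := inferInstance
  t2_base := t2Space_of_properlyDiscontinuousSMul_of_t2Space
  countable_base := ContinuousConstSMul.secondCountableTopology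
  dim_base := by simp
  finite_base := inferInstance
  connected_base := inferInstance
  symplectic := isSymplecticForm_omega0
  compact_fibre := inferInstance
  smooth := contMDiff_proj0
  submersion := surjective_mfderiv_proj0
  locally_trivial b := by
    obtain ⟨y, rfl⟩ := surjective_coverX b
    obtain ⟨e, hy, he⟩ := isLocalHomeomorph_coverX y
    exact ⟨stdTriv e he.symm, (congrFun he y ▸ e.map_source hy : coverX y ∈ e.target)⟩
  lagrangian := omega0_eq_zero_of_vertical

/-! ### Transition between action-angle coordinates and the standard ones -/

theorem surjective_toTorus {n : ℕ} : Function.Surjective (toTorus (n := n)) := by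
  intro t
  choose s hs using fun i => QuotientAddGroup.mk_surjective (t i)
  exact ⟨WithLp.toLp 2 s, funext hs⟩

theorem mk_right_injective {y : XTilde} {t t' : Torus 3}
    (h : (⟦(y, t)⟧ : M0) = ⟦(y, t')⟧) : t = t' := by
  obtain ⟨a, ha⟩ := isQuotientCoveringMap_mkM0.apply_eq_iff_mem_orbit.1 h
  obtain rfl := units_eq_one_of_smul_eq a y (congrArg Prod.fst ha)
  simpa using (congrArg Prod.snd ha).symm

theorem exists_mk_eq {m : M0} {y : XTilde} (h : proj0 m = coverX y) :
    ∃ t, m = ⟦(y, t)⟧ := by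
  obtain ⟨p, rfl⟩ := Quotient.exists_rep m
  obtain ⟨a, ha⟩ := isQuotientCoveringMap_coverX.apply_eq_iff_mem_orbit.1 h.symm
  refine ⟨a • p.2, ?_⟩
  have h2 : a • p = (y, a • p.2) := Prod.ext ha rfl
  rw [← h2]
  exact (isQuotientCoveringMap_mkM0.map_smul a).symm

/-- Written with inner products, the symplectic condition turns into a statement about adjoints. -/
theorem stdForm_eq_inner {n : ℕ} (v w : EuclideanSpace ℝ (Fin n) × EuclideanSpace ℝ (Fin n)) :
    stdForm v w = inner ℝ v.1 w.2 - inner ℝ v.2 w.1 := by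
  simp only [stdForm, PiLp.inner_apply, Finset.sum_sub_distrib, RCLike.inner_apply, conj_trivial]
  simp only [mul_comm]

section Transition

variable (C : ActionAngleChart R3 3 omega0 proj0)

/-- The parametrisation of `M₀` by action-angle coordinates. -/
noncomputable def ActionAngleChart.param (p : R3 × R3) : M0 :=
  C.triv.toOpenPartialHomeomorph.symm (C.action.symm p.1, toTorus p.2)

variable {C}

theorem mdifferentiableAt_param {p : R3 × R3} (hp : p.1 ∈ C.action.target) :
    MDifferentiableAt 𝓘(ℝ, R3 × R3) 𝓘(ℝ, R3 × R3) C.param p :=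
  (C.smooth_param.contMDiffAt ((C.action.open_target.prod isOpen_univ).mem_nhds
    ⟨hp, trivial⟩)).mdifferentiableAt (by simp)

theorem proj0_triv_symm {b : X} (hb : b ∈ C.action.source) (t : Torus 3) :
    proj0 (C.triv.toOpenPartialHomeomorph.symm (b, t)) = b :=
  C.triv.proj_symm_apply' (C.baseSet_eq.symm ▸ hb)

theorem triv_symm_injective {b : X} (hb : b ∈ C.action.source) :
    Function.Injective fun t => C.triv.toOpenPartialHomeomorph.symm (b, t) := by
  intro t t' h
  have hb' : b ∈ C.triv.baseSet := C.baseSet_eq.symm ▸ hb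
  have h1 := C.triv.toOpenPartialHomeomorph.symm.injOn (x₁ := (b, t)) (x₂ := (b, t'))
    (by simpa [C.triv.target_eq] using hb') (by simpa [C.triv.target_eq] using hb') h
  exact congrArg Prod.snd h1

theorem proj0_param {p : R3 × R3} (hp : p.1 ∈ C.action.target) :
    proj0 (C.param p) = C.action.symm p.1 :=
  proj0_triv_symm (C.action.map_target hp) _

/-! ### Derivatives of general action-angle coordinates relative to the covering charts -/

section Jacobian

variable {c' : OpenPartialHomeomorph X R3} (hc' : c' ∈ atlas R3 X) {x : R3}
  (hx : x ∈ C.action.target) (hx' : C.action.symm x ∈ c'.source)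

include hc' hx hx'

theorem differentiableAt_chart_comp_action_symm : DifferentiableAt ℝ (c' ∘ C.action.symm) x :=
  differentiableAt_chart_comp hc' hx' ((C.smooth_action_symm.contMDiffAt
    (C.action.open_target.mem_nhds hx)).mdifferentiableAt (by simp))

theorem contDiffAt_action_comp_chart_symm :
    ContDiffAt ℝ ∞ (C.action ∘ c'.symm) (c' (C.action.symm x)) := by
  have h1 : ContMDiffAt 𝓘(ℝ, R3) 𝓘(ℝ, R3) ∞ c'.symm (c' (C.action.symm x)) :=
    contMDiffAt_symm_of_mem_maximalAtlas (IsManifold.subset_maximalAtlas hc') (c'.map_source hx')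
  have h2 : ContMDiffAt 𝓘(ℝ, R3) 𝓘(ℝ, R3) ∞ C.action (c'.symm (c' (C.action.symm x))) := by
    rw [c'.left_inv hx']
    exact C.smooth_action.contMDiffAt (C.action.open_source.mem_nhds (C.action.map_target hx))
  exact (h2.comp _ h1).contDiffAt

theorem fderiv_action_comp_fderiv (a : R3) :
    fderiv ℝ (C.action ∘ c'.symm) (c' (C.action.symm x))
      (fderiv ℝ (c' ∘ C.action.symm) x a) = a := by
  have h1 := (contDiffAt_action_comp_chart_symm hc' hx hx').differentiableAt (by simp)
  have h2 := differentiableAt_chart_comp_action_symm hc' hx hx'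
  have h3 := fderiv_comp x (g := C.action ∘ c'.symm) (f := c' ∘ C.action.symm) h1 h2
  have h4 : (C.action ∘ c'.symm) ∘ (c' ∘ C.action.symm) =ᶠ[𝓝 x] id := by
    filter_upwards [C.action.open_target.mem_nhds hx,
      (C.action.continuousAt_symm hx).eventually (c'.open_source.mem_nhds hx')] with z h5 h6
    simp [c'.left_inv h6, C.action.right_inv h5]
  rw [h4.fderiv_eq, fderiv_id] at h3
  exact (DFunLike.congr_fun h3 a).symm

/-- In finite dimension a one-sided inverse is two-sided. -/
theorem fderiv_comp_fderiv_action (a : R3) :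
    fderiv ℝ (c' ∘ C.action.symm) x
      (fderiv ℝ (C.action ∘ c'.symm) (c' (C.action.symm x)) a) = a := by
  have h := fderiv_action_comp_fderiv hc' hx hx'
  have hinj : Function.Injective (fderiv ℝ (c' ∘ C.action.symm) x) := fun u v huv => by
    rw [← h u, huv, h v]
  obtain ⟨b, rfl⟩ := (LinearMap.injective_iff_surjective
    (f := (fderiv ℝ (c' ∘ C.action.symm) x : R3 →ₗ[ℝ] R3))).1 hinj a
  exact congrArg _ (h b)

variable {c : OpenPartialHomeomorph M0 (R3 × R3)} (hc : c ∈ atlas (R3 × R3) M0) {s : R3}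
  (hp : C.param (x, s) ∈ c.source)
  (hev : ∀ᶠ m in 𝓝 (C.param (x, s)), c' (proj0 m) = (c m).1)

include hc hp hev

/-- The derivative of the angles with respect to the angles is the transpose of the derivative of
the actions with respect to the actions. -/
theorem fderiv_angle (d : R3) : (fderiv ℝ (c ∘ C.param) (x, s) (0, d)).2 =
    ContinuousLinearMap.adjoint
      (fderiv ℝ (C.action ∘ c'.symm) (c' (C.action.symm x))) d := by
  have hg := mdifferentiableAt_param (C := C) (p := (x, s)) hx
  have hd := differentiableAt_chart_comp hc hp hg
  have h1 : ∀ v : R3 × R3, (fderiv ℝ (c ∘ C.param) (x, s) v).1 = fderiv ℝ (c' ∘ C.action.symm) x v.1 := by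
    intro v
    have h2 : (fun p => ((c ∘ C.param) p).1) =ᶠ[𝓝 (x, s)] (c' ∘ C.action.symm) ∘ Prod.fst := by
      filter_upwards [hg.continuousAt.eventually hev,
        continuousAt_fst.eventually (C.action.open_target.mem_nhds hx)] with p h3 h4
      rw [Function.comp_apply, ← h3, proj0_param h4]
      rfl
    have h5 := h2.fderiv_eq (𝕜 := ℝ)
    rw [fderiv.fst hd, fderiv_comp (x, s)
      (differentiableAt_chart_comp_action_symm hc' hx hx') differentiableAt_fst, fderiv_fst] at h5
    exact DFunLike.congr_fun h5 v
  refine ext_inner_left ℝ fun a => ?_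
  rw [ContinuousLinearMap.adjoint_inner_right]
  -- With `A` the Jacobian of the actions, evaluate the form on the images of `(A a, 0)` and `(0,
  -- d)`. The first has action component `a`, the second is vertical, so the angle component of the
  -- second paired with `a` must equal `⟨A a, d⟩`.
  have h6 := (omega0_mfderiv hc hp hg
    (fderiv ℝ (C.action ∘ c'.symm) (c' (C.action.symm x)) a, 0) (0, d)).symm.trans
    (C.symplectic (x, s) _ _ hx)
  rw [stdForm_eq_inner, stdForm_eq_inner, h1, h1, fderiv_comp_fderiv_action hc' hx hx'] at h6
  simpa using h6

/-- The derivative depends on the fibre only and not on `s`; this makes the change of angles affine.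
-/
theorem hasFDerivAt_angle : HasFDerivAt (fun s' => (c (C.param (x, s'))).2)
    (ContinuousLinearMap.adjoint (fderiv ℝ (C.action ∘ c'.symm) (c' (C.action.symm x)))) s := by
  have hg := mdifferentiableAt_param (C := C) (p := (x, s)) hx
  have hd := (differentiableAt_chart_comp hc hp hg).hasFDerivAt
  have h1 := (hd.comp s ((hasFDerivAt_const x s).prodMk (hasFDerivAt_id s))).snd
  refine h1.congr_fderiv ?_
  ext1 d
  exact fderiv_angle hc' hx hx' hc hp hev d

end Jacobian

/-- The angles of action-angle coordinates depend affinely on the standard angles. -/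
theorem exists_triv_symm_eq {y : XTilde} (hb : coverX y ∈ C.action.source)
    {c' : OpenPartialHomeomorph X R3} (hc' : c' ∈ atlas R3 X) (hy : coverX y ∈ c'.source)
    (hev : ∀ᶠ w in 𝓝 y, c' (coverX w) = w.1) : ∃ t₀ : Torus 3, ∀ s : R3,
      C.triv.toOpenPartialHomeomorph.symm (coverX y, toTorus s) = ⟦(y, toTorus
        (ContinuousLinearMap.adjoint (fderiv ℝ (C.action ∘ c'.symm) y.1) s) + t₀)⟧ := by
  have hcy : c' (coverX y) = y.1 := hev.self_of_nhds
  set x := C.action (coverX y) with hxdef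
  have hx : x ∈ C.action.target := C.action.map_source hb
  have hsx : C.action.symm x = coverX y := C.action.left_inv hb
  set L := ContinuousLinearMap.adjoint (fderiv ℝ (C.action ∘ c'.symm) y.1) with hL
  have hpar : ∀ s, C.triv.toOpenPartialHomeomorph.symm (coverX y, toTorus s) = C.param (x, s) := by
    intro s
    rw [ActionAngleChart.param, hsx]
  have hex : ∀ s, ∃ t, C.param (x, s) = ⟦(y, t)⟧ := fun s =>
    exists_mk_eq (by rw [proj0_param hx, hsx])
  choose τ hτ using hex
  -- `τ s` is the standard angle of the point with new angle `s`. In a chart of `M0` it lifts to a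
  -- map with constant derivative `L`, so on a ball it differs from `L` by a constant; connectedness
  -- of `ℝ³` makes the constant global.
  have hloc : IsLocallyConstant fun s => τ s - toTorus (L s) := by
    rw [IsLocallyConstant.iff_eventually_eq]
    intro s₀
    obtain ⟨u, hu⟩ := surjective_toTorus (τ s₀)
    have hm₀ : C.param (x, s₀) = coverM0 (y, u) := by rw [hτ, ← hu]; rfl
    obtain ⟨c, hc, hm, h1, h2⟩ := exists_chart_M0 (y, u)
    have h3 := eventually_chart_proj0 hm h1 h2 hev
    rw [← hm₀] at h3 hm
    have hcont : ContinuousAt (fun s => C.param (x, s)) s₀ :=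
      (mdifferentiableAt_param (C := C) (p := (x, s₀)) hx).continuousAt.comp
        (continuousAt_const.prodMk continuousAt_id)
    have h4 := hcont.eventually ((c.open_source.eventually_mem hm).and
      h3.eventually_nhds)
    obtain ⟨r, hr, hball⟩ := Metric.eventually_nhds_iff_ball.1 h4
    have hd : ∀ s ∈ Metric.ball s₀ r, HasFDerivAt (fun s' => (c (C.param (x, s'))).2) L s := by
      intro s hs
      have h5 := hasFDerivAt_angle hc' hx (hsx ▸ hy) hc (hball s hs).1 (hball s hs).2
      rwa [hsx, hcy] at h5
    obtain ⟨a, ha⟩ := Metric.isOpen_ball.exists_eq_add_of_fderiv_eq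
      (convex_ball s₀ r).isPreconnected
      (fun s hs => (hd s hs).differentiableAt.differentiableWithinAt)
      L.differentiable.differentiableOn
      (fun s hs => by rw [(hd s hs).fderiv, L.fderiv])
    have hval : ∀ s ∈ Metric.ball s₀ r, τ s - toTorus (L s) = toTorus a := by
      intro s hs
      obtain ⟨w, hw, hw'⟩ := h2 _ (hball s hs).1
      have h6 := (hball s hs).2.self_of_nhds
      rw [proj0_param hx, hsx, hcy, hw'] at h6
      have h7 : w.1 = y := Subtype.ext h6.symm
      have h8 : (⟦(y, τ s)⟧ : M0) = ⟦(y, toTorus w.2)⟧ := by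
        rw [← hτ, ← hw, ← h7]; rfl
      have h9 := ha hs
      simp only [hw'] at h9
      rw [mk_right_injective h8, ← toTorus_sub, h9, add_sub_cancel_left]
    filter_upwards [Metric.ball_mem_nhds s₀ hr] with s hs
    rw [hval s hs, hval s₀ (Metric.mem_ball_self hr)]
  refine ⟨τ 0 - toTorus (L 0), fun s => ?_⟩
  rw [hpar, hτ, ← hloc.apply_eq_of_preconnectedSpace s 0, add_sub_cancel]

/-! ### Integrality of linear maps preserving the lattice -/

theorem toTorus_eq_zero_iff {n : ℕ} (s : EuclideanSpace ℝ (Fin n)) :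
    toTorus s = 0 ↔ ∀ i, ∃ z : ℤ, (z : ℝ) = s i := by
  rw [funext_iff]
  refine forall_congr' fun i => ?_
  refine (AddCircle.coe_eq_zero_iff (1 : ℝ) (x := s i)).trans ?_
  simp only [zsmul_eq_mul, mul_one]

theorem euclidean_sum_single {n : ℕ} (s : EuclideanSpace ℝ (Fin n)) :
    ∑ j, s j • EuclideanSpace.single j (1 : ℝ) = s := by
  ext i
  simp [Finset.sum_apply, Pi.single_apply]

/-- A linear automorphism of `ℝⁿ` that preserves the lattice `ℤⁿ` has a matrix in `GL(n,ℤ)`. -/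
theorem exists_GL_of_lattice {n : ℕ}
    (L : EuclideanSpace ℝ (Fin n) ≃ₗ[ℝ] EuclideanSpace ℝ (Fin n))
    (h : ∀ s, toTorus (L s) = 0 ↔ toTorus s = 0) :
    ∃ g : GL (Fin n) ℤ, ∀ s i, L s i = ∑ j, (g i j : ℝ) * s j := by
  have key : ∀ K : EuclideanSpace ℝ (Fin n) →ₗ[ℝ] EuclideanSpace ℝ (Fin n),
      (∀ s, toTorus s = 0 → toTorus (K s) = 0) →
      ∃ N : Matrix (Fin n) (Fin n) ℤ, ∀ s i, K s i = ∑ j, (N i j : ℝ) * s j := by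
    intro K hK
    have h1 : ∀ j, toTorus (EuclideanSpace.single j (1 : ℝ) : EuclideanSpace ℝ (Fin n)) = 0 := by
      intro j
      rw [toTorus_eq_zero_iff]
      intro i
      refine ⟨if i = j then 1 else 0, ?_⟩
      simp
    have h2 := fun j => (toTorus_eq_zero_iff _).1 (hK _ (h1 j))
    choose N hN using h2
    -- `N j` collects the coordinates of the image of the `j`-th basis vector, that is, a column.
    refine ⟨fun i j => N j i, fun s i => ?_⟩
    conv_lhs => rw [← euclidean_sum_single s, map_sum]
    simp [Finset.sum_apply, hN, mul_comm]
  obtain ⟨N, hN⟩ := key L.toLinearMap fun s => (h s).2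
  obtain ⟨N', hN'⟩ := key L.symm.toLinearMap fun s hs => (h _).1 (by simpa using hs)
  have h1 : N * N' = 1 := by
    ext i k
    have h2 := hN (L.symm (EuclideanSpace.single k 1)) i
    have h3 : ∀ j, L.symm (EuclideanSpace.single k 1) j = (N' j k : ℝ) := by
      intro j
      have := hN' (EuclideanSpace.single k 1) j
      simpa [Pi.single_apply] using this
    simp only [LinearEquiv.coe_coe, LinearEquiv.apply_symm_apply, h3] at h2
    rw [Matrix.mul_apply, Matrix.one_apply]
    have h4 : ((∑ j, N i j * N' j k : ℤ) : ℝ) = ((if i = k then 1 else 0 : ℤ) : ℝ) := by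
      push_cast
      rw [← h2]
      simp
    exact_mod_cast h4
  exact ⟨⟨N, N', h1, mul_eq_one_comm.1 h1⟩, hN⟩

theorem AffTorus.act_apply {n : ℕ} (g : AffTorus n) (t : Torus n) (i : Fin n) :
    g.act t i = ∑ j, g.lin i j • t j + g.trans i := rfl

/-- A frame of `M₀ → X` is an affine reparametrisation of the standard one. -/
theorem exists_frame_eq {y : XTilde} (hb : coverX y ∈ C.action.source)
    {c' : OpenPartialHomeomorph X R3} (hc' : c' ∈ atlas R3 X) (hy : coverX y ∈ c'.source)
    (hev : ∀ᶠ w in 𝓝 y, c' (coverX w) = w.1) : ∃ g : AffTorus 3,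
      (∀ t, C.triv.toOpenPartialHomeomorph.symm (coverX y, t) = ⟦(y, g.act t)⟧) ∧
      ∀ a i, fderiv ℝ (C.action ∘ c'.symm) y.1 a i = ∑ j, (g.lin j i : ℝ) * a j := by
  obtain ⟨t₀, ht₀⟩ := exists_triv_symm_eq hb hc' hy hev
  have hx := C.action.map_source hb
  have hsx := C.action.left_inv hb
  have hcy : c' (coverX y) = y.1 := hev.self_of_nhds
  set ν := fderiv ℝ (C.action ∘ c'.symm) y.1 with hν
  have hsurj : Function.Surjective ν := by
    intro a
    have h1 := fderiv_action_comp_fderiv (C := C) hc' hx (hsx.symm ▸ hy) a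
    rw [hsx, hcy] at h1
    exact ⟨_, h1⟩
  have hinj : Function.Injective (ContinuousLinearMap.adjoint ν) := by
    rw [injective_iff_map_eq_zero]
    intro s hs
    refine ext_inner_left ℝ fun a => ?_
    obtain ⟨a, rfl⟩ := hsurj a
    rw [← ContinuousLinearMap.adjoint_inner_right, hs, inner_zero_right, inner_zero_right]
  let L : R3 ≃ₗ[ℝ] R3 := LinearEquiv.ofInjectiveEndo
    (ContinuousLinearMap.adjoint ν : R3 →ₗ[ℝ] R3) hinj
  have hL : ∀ s, L s = ContinuousLinearMap.adjoint ν s := fun s => rfl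
  -- Both parametrisations of the fibre by the torus are injective. Comparing the points with angles
  -- `s` and `0` shows that one of `s`, `L s` is integral exactly when the other is.
  obtain ⟨g, hg⟩ := exists_GL_of_lattice L (by
    intro s
    have h0 : toTorus (0 : R3) = 0 := by rw [toTorus_eq_zero_iff]; exact fun i => ⟨0, by simp⟩
    have h1 := ht₀ 0
    rw [map_zero, h0, zero_add] at h1
    rw [hL]
    constructor
    · intro h
      have h2 := ht₀ s
      rw [h, zero_add, ← h1] at h2
      exact triv_symm_injective hb h2
    · intro h
      have h2 := ht₀ s
      rw [h, h1] at h2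
      simpa using (mk_right_injective h2).symm)
  refine ⟨⟨g, t₀⟩, fun t => ?_, fun a i => ?_⟩
  · obtain ⟨s, rfl⟩ := surjective_toTorus t
    rw [ht₀]
    refine congrArg (fun t => (⟦(y, t)⟧ : M0)) (funext fun i => ?_)
    rw [AffTorus.act_apply]
    change ((ContinuousLinearMap.adjoint ν s i : ℝ) : UnitAddCircle) + t₀ i = _
    rw [← hL, hg]
    congr 1
    rw [QuotientAddGroup.mk_sum]
    refine Finset.sum_congr rfl fun j _ => ?_
    rw [← zsmul_eq_mul]
    rfl
  -- `L` is the adjoint of `ν`, so the Jacobian is the transpose of the linear part `g`.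
  · have h1 : ν a i = inner ℝ (EuclideanSpace.single i (1 : ℝ)) (ν a) := by
      simp [EuclideanSpace.inner_single_left]
    rw [h1, ← ContinuousLinearMap.adjoint_inner_left, ← hL, PiLp.inner_apply]
    refine Finset.sum_congr rfl fun j _ => ?_
    rw [hg]
    simp [mul_comm]

end Transition

/-! ### Affine automorphisms of the torus -/

namespace AffTorus

variable {n : ℕ}

open scoped Matrix.Module in
theorem act_mul (g h : AffTorus n) (t : Torus n) : (g * h).act t = g.act (h.act t) := by
  simp only [act, mul_lin, mul_trans, Units.val_mul, mul_smul, smul_add, add_assoc]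

theorem act_zero (g : AffTorus n) : g.act 0 = g.trans := by
  ext i
  simp [act_apply]

end AffTorus

theorem int_eq_zero_of_norm_smul_lt {m : ℤ} (h : ∀ s : UnitAddCircle, ‖m • s‖ < 1 / 2) : m = 0 := by
  by_contra hm
  have hm' : (m : ℝ) ≠ 0 := by exact_mod_cast hm
  -- Multiplication by `m` sends this point to `1/2`, the point of the circle of norm exactly `1/2`.
  have h1 := h ((1 / (2 * m) : ℝ) : UnitAddCircle)
  have h2 : m • ((1 / (2 * m) : ℝ) : UnitAddCircle) = ((1 / 2 : ℝ) : UnitAddCircle) := by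
    rw [← AddCircle.coe_zsmul]
    congr 1
    rw [zsmul_eq_mul]
    field_simp
  rw [h2, UnitAddCircle.norm_eq] at h1
  norm_num at h1

/-- Uniform closeness detects the linear part. Subtracting the values at `0` removes the
translations at the cost of doubling the bound to `1/2`, below which no nonzero integer
multiplication of the circle can stay. -/
theorem AffTorus.lin_eq_of_norm_lt {n : ℕ} {g g' : AffTorus n}
    (h : ∀ t, ‖g.act t - g'.act t‖ < 1 / 4) : g.lin = g'.lin := by
  ext i j
  rw [← sub_eq_zero]
  refine int_eq_zero_of_norm_smul_lt fun s => ?_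
  have h0 := (norm_le_pi_norm _ i).trans_lt (h 0)
  have h1 := (norm_le_pi_norm _ i).trans_lt (h (Pi.single j s))
  have h2 : ∀ k : AffTorus n, k.act (Pi.single j s) i = k.lin i j • s + k.trans i := by
    intro k
    rw [act_apply]
    congr 1
    rw [Finset.sum_eq_single j]
    · simp
    · intro l _ hl
      simp [hl]
    · simp
  rw [Pi.sub_apply, h2, h2] at h1
  rw [Pi.sub_apply, act_zero, act_zero] at h0
  have h3 : ((g.lin i j : ℤ) - g'.lin i j) • s =
      (g.lin i j • s + g.trans i - (g'.lin i j • s + g'.trans i)) - (g.trans i - g'.trans i) := by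
    rw [sub_smul]; abel
  rw [h3]
  calc _ ≤ _ := norm_sub_le _ _
    _ < 1 / 4 + 1 / 4 := add_lt_add h1 h0
    _ = 1 / 2 := by norm_num

theorem AffTorus.act_injective {n : ℕ} {g g' : AffTorus n} (h : ∀ t, g.act t = g'.act t) :
    g = g' := by
  refine AffTorus.ext (lin_eq_of_norm_lt fun t => by simp [h]) ?_
  rw [← act_zero, ← act_zero, h]

theorem AffTorus.continuousAt_of {n : ℕ} {α : Type*} [TopologicalSpace α] {f : α → AffTorus n} {a : α}
    (h1 : ∀ᶠ x in 𝓝 a, (f x).lin = (f a).lin) (h2 : ContinuousAt (fun x => (f x).trans) a) :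
    ContinuousAt f a := by
  have h3 : Topology.IsInducing (fun g : AffTorus n => (g.lin, g.trans)) := ⟨rfl⟩
  rw [h3.continuousAt_iff]
  refine ContinuousAt.prodMk ?_ h2
  exact continuousAt_const.congr (h1.mono fun x hx => hx.symm)

open scoped Matrix.Module in
-- Once the linear part is frozen, inversion acts on the translation by one fixed matrix.
theorem AffTorus.continuousAt_inv_of {n : ℕ} {α : Type*} [TopologicalSpace α] {f : α → AffTorus n}
    {a : α} (h1 : ∀ᶠ x in 𝓝 a, (f x).lin = (f a).lin)
    (h2 : ContinuousAt (fun x => (f x).trans) a) : ContinuousAt (fun x => (f x)⁻¹) a := by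
  refine continuousAt_of (h1.mono fun x hx => by rw [inv_lin, inv_lin, hx]) ?_
  have h3 : Continuous fun t : Torus n =>
      -((((f a).lin⁻¹ : GL (Fin n) ℤ) : Matrix (Fin n) (Fin n) ℤ) • t) := by
    refine Continuous.neg (continuous_pi fun i => ?_)
    simp only [Matrix.Module.smul_apply]
    fun_prop
  refine (h3.continuousAt.comp h2).congr (h1.mono fun x hx => ?_)
  simp only [Function.comp_apply, inv_trans, hx]

/-! ### Frames of `M₀ → X` -/

/-- The principal bundle associated to `M₀ → X`. -/
abbrev Frames := FrameBundle R3 3 omega0 proj0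

/-- The base point of a frame. -/
def Frames.base (φ : Frames) : X := proj0 (φ.1 0)

theorem Frames.proj0_apply (φ : Frames) (t : Torus 3) : proj0 (φ.1 t) = φ.base := by
  obtain ⟨φ, C, b, hb, h⟩ := φ
  simp only [Frames.base, h, proj0_triv_symm hb]

theorem Frames.continuous_base : Continuous Frames.base :=
  continuous_proj0.comp ((continuous_eval_const (0 : Torus 3)).comp continuous_subtype_val)

theorem Frames.exists_eq (φ : Frames) {y : XTilde} (hy : coverX y = φ.base) :
    ∃ g : AffTorus 3, ∀ t, φ.1 t = ⟦(y, g.act t)⟧ := by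
  obtain ⟨φ, C, b, hb, h⟩ := φ
  have hb' : coverX y = b := by
    rw [hy, Frames.base, h, proj0_triv_symm hb]
  subst hb'
  obtain ⟨c', hc', hyc, hev, -⟩ := exists_chart_X y
  obtain ⟨g, hg, -⟩ := exists_frame_eq hb hc' hyc hev
  exact ⟨g, fun t => (h t).trans (hg t)⟩

open Classical in
/-- The affine automorphism by which a frame differs from the standard frame at `y`. -/
noncomputable def Frames.coord (φ : Frames) (y : XTilde) : AffTorus 3 :=
  if h : coverX y = φ.base then (φ.exists_eq h).choose else 1

theorem Frames.apply_eq (φ : Frames) {y : XTilde} (hy : coverX y = φ.base) (t : Torus 3) :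
    φ.1 t = ⟦(y, (φ.coord y).act t)⟧ := by
  rw [Frames.coord, dif_pos hy]
  exact (φ.exists_eq hy).choose_spec t

theorem Frames.coord_eq (φ : Frames) {y : XTilde} (hy : coverX y = φ.base) {g : AffTorus 3}
    (hg : ∀ t, φ.1 t = ⟦(y, g.act t)⟧) : φ.coord y = g :=
  AffTorus.act_injective fun t => mk_right_injective ((φ.apply_eq hy t).symm.trans (hg t))

/-- The standard frame at `y`. -/
noncomputable def stdFrame (y : XTilde) : Frames :=
  ⟨⟨fun t => ⟦(y, t)⟧, isQuotientCoveringMap_mkM0.continuous.comp (Continuous.prodMk_right y)⟩, by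
    obtain ⟨e, hy, he⟩ := isLocalHomeomorph_coverX y
    refine ⟨stdChart e he.symm, coverX y, ?_, fun t => ?_⟩
    · change _ ∈ (stdAction e).source
      rw [stdAction_source, he]
      exact e.map_source hy
    · change _ = (⟦(e.symm (coverX y), t)⟧ : M0)
      rw [he, e.left_inv hy]
      rfl⟩

theorem stdFrame_apply (y : XTilde) (t : Torus 3) : (stdFrame y).1 t = ⟦(y, t)⟧ := rfl

theorem continuous_stdFrame : Continuous stdFrame :=
  Continuous.subtype_mk (ContinuousMap.curry ⟨fun p : XTilde × Torus 3 => (⟦p⟧ : M0),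
    isQuotientCoveringMap_mkM0.continuous⟩).continuous _

/-- The affine automorphism `t ↦ -t`. -/
def negAff : AffTorus 3 := ⟨-1, 0⟩

theorem negAff_act (t : Torus 3) : negAff.act t = -t := by
  ext i
  simp only [AffTorus.act_apply, negAff]
  fin_cases i <;> simp [Fin.sum_univ_three]

/-- The source of the monodromy: passing from the lift `y` to `-y` changes the standard frame by an
automorphism with linear part `-I`. -/
theorem stdFrame_neg_apply (y : XTilde) (t : Torus 3) :
    (stdFrame ((-1 : ℤˣ) • y)).1 (negAff.act t) = (stdFrame y).1 t := by
  rw [negAff_act, stdFrame_apply, stdFrame_apply]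
  have h : (((-1 : ℤˣ) • y, -t) : XTilde × Torus 3) = (-1 : ℤˣ) • (y, t) :=
    Prod.ext rfl (by simp)
  rw [h]
  exact isQuotientCoveringMap_mkM0.map_smul (-1)

/-! ### Continuity of the coordinates of frames -/

/-- A trivialisation reads off the map `t ↦ (coord φ).act t`. Compactness of the torus turns
closeness of frames in the compact-open topology into uniform closeness of these maps, so the linear
part is locally constant; the translation is the value at `0`. -/
theorem continuousAt_coord {φ₀ : Frames} {sec : X → XTilde} (hs : ∀ᶠ b in 𝓝 φ₀.base, coverX (sec b) = b)
    (hsc : ContinuousAt sec φ₀.base) :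
    ContinuousAt (fun φ : Frames => (φ.coord (sec φ.base))⁻¹) φ₀ := by
  obtain ⟨e, hy, he⟩ := isLocalHomeomorph_coverX (sec φ₀.base)
  have h0 : coverX (sec φ₀.base) = φ₀.base := hs.self_of_nhds
  have h1 : ∀ᶠ φ in 𝓝 φ₀, coverX (sec (Frames.base φ)) = φ.base ∧ sec φ.base ∈ e.source :=
    Frames.continuous_base.continuousAt.eventually
      (hs.and (hsc.eventually (e.open_source.mem_nhds hy)))
  let T := stdTriv e he.symm
  have hT : ∀ y ∈ e.source, ∀ t : Torus 3, T (⟦(y, t)⟧ : M0) = (coverX y, t) := by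
    intro y hy t
    have h2 := T.toOpenPartialHomeomorph.right_inv (x := (coverX y, t)) (by
      rw [T.target_eq]
      exact ⟨(congrFun he y ▸ e.map_source hy : coverX y ∈ e.target), trivial⟩)
    have h3 : T.toOpenPartialHomeomorph.symm (coverX y, t) = (⟦(y, t)⟧ : M0) := by
      rw [stdTriv_symm_apply, he, e.left_inv hy]
    rw [h3] at h2
    exact h2
  have h2 : ∀ᶠ φ in 𝓝 φ₀, ∀ t, (T ((φ : Frames).1 t)).2 = (φ.coord (sec φ.base)).act t := by
    filter_upwards [h1] with φ hφ t
    rw [φ.apply_eq hφ.1, hT _ hφ.2]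
  have h3 : ∀ t, ContinuousAt (fun p : Frames × Torus 3 => (T (p.1.1 p.2)).2) (φ₀, t) := by
    intro t
    have h4 : Continuous fun p : Frames × Torus 3 => p.1.1 p.2 := by fun_prop
    have h5 : φ₀.1 t ∈ T.source := by
      rw [T.mem_source, φ₀.proj0_apply, ← h0]
      exact (congrFun he _ ▸ e.map_source hy : coverX (sec φ₀.base) ∈ e.target)
    exact continuousAt_snd.comp ((T.toOpenPartialHomeomorph.continuousAt h5).comp
      (f := fun p : Frames × Torus 3 => p.1.1 p.2) h4.continuousAt)
  have h4 : ∀ t, ContinuousAt (fun φ : Frames => (T (φ.1 t)).2) φ₀ := fun t =>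
    (h3 t).comp (f := fun φ : Frames => (φ, t)) (continuousAt_id.prodMk continuousAt_const)
  refine AffTorus.continuousAt_inv_of ?_ ?_
  · have h5 : ∀ t, ∀ᶠ p : Frames × Torus 3 in 𝓝 φ₀ ×ˢ 𝓝 t,
        ‖(T (p.1.1 p.2)).2 - (T (φ₀.1 p.2)).2‖ < 1 / 4 := by
      intro t
      rw [← nhds_prod_eq]
      have h6 : ContinuousAt (fun p : Frames × Torus 3 =>
          ‖(T (p.1.1 p.2)).2 - (T (φ₀.1 p.2)).2‖) (φ₀, t) :=
        ((h3 t).sub ((h3 t).comp_of_eq (f := fun p : Frames × Torus 3 => (φ₀, p.2))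
          (continuousAt_const.prodMk continuousAt_snd) rfl)).norm
      refine h6.eventually (gt_mem_nhds ?_)
      simp
    have h7 := isCompact_univ.eventually_forall_of_forall_eventually
      (x₀ := φ₀) (K := (Set.univ : Set (Torus 3)))
      (P := fun φ t => ‖(T (φ.1 t)).2 - (T (φ₀.1 t)).2‖ < 1 / 4)
      (fun t _ => by rw [nhds_prod_eq]; exact h5 t)
    filter_upwards [h7, h2] with φ h8 h9
    refine AffTorus.lin_eq_of_norm_lt fun t => ?_
    rw [← h9, ← h2.self_of_nhds]
    exact h8 t trivial
  · refine (h4 0).congr (h2.mono fun φ h => ?_)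
    exact (h 0).trans (AffTorus.act_zero _)

/-! ### Local sections of `ℝ³ ∖ 0 → X` and a partition of unity -/

/-- A lift of a point of `X`, with positive `i`-th coordinate if this is possible. -/
noncomputable def posLift (i : Fin 3) (b : X) : XTilde :=
  if 0 < (Quotient.out b).1 i then Quotient.out b else (-1 : ℤˣ) • Quotient.out b

theorem coverX_posLift (i : Fin 3) (b : X) : coverX (posLift i b) = b := by
  have h : coverX (Quotient.out b) = b := Quotient.out_eq b
  unfold posLift
  split_ifs
  · exact h
  · rw [isQuotientCoveringMap_coverX.map_smul, h]

theorem posLift_coverX {i : Fin 3} {y : XTilde} (hy : 0 < y.1 i) : posLift i (coverX y) = y := by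
  have h : coverX (Quotient.out (coverX y)) = coverX y := Quotient.out_eq (coverX y)
  unfold posLift
  rcases (coverX_eq_iff _ _).1 h with h1 | h1
  · rw [if_pos (by rwa [h1])]
    exact Subtype.ext h1
  · have h2 : ¬ 0 < (Quotient.out (coverX y)).1 i := by
      rw [h1, PiLp.neg_apply]
      linarith
    rw [if_neg h2]
    exact Subtype.ext (by simp [coe_smul, h1])

/-- The points `coverX y` with `y i > 0` are exactly those where `coordSq i` is nonzero, so the
discontinuities of this section are invisible in the join. -/
theorem continuousAt_posLift {i : Fin 3} {y : XTilde} (hy : 0 < y.1 i) :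
    ContinuousAt (posLift i) (coverX y) := by
  obtain ⟨e, hye, he⟩ := isLocalHomeomorph_coverX y
  have hb : coverX y ∈ e.target := (congrFun he y ▸ e.map_source hye : coverX y ∈ e.target)
  have hey : e.symm (coverX y) = y := by rw [he, e.left_inv hye]
  have hc := e.continuousAt_symm hb
  have hpos : Continuous fun z : XTilde => z.1 i := by fun_prop
  have h1 : ∀ᶠ b in 𝓝 (coverX y), 0 < (e.symm b).1 i :=
    hc.eventually (hpos.continuousAt.eventually (lt_mem_nhds (hey.symm ▸ hy)))
  refine hc.congr ?_
  filter_upwards [h1, e.open_target.mem_nhds hb] with b h2 h3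
  have h4 := posLift_coverX h2
  rwa [he, e.right_inv h3, eq_comm] at h4

/-- The function `[x] ↦ xᵢ² / ‖x‖²`. -/
noncomputable def coordSq (i : Fin 3) : X → ℝ :=
  Quotient.lift (fun y : XTilde => y.1 i ^ 2 / ‖y.1‖ ^ 2) (by
    intro x y h
    have h' : coverX x = coverX y := Quotient.sound h
    rcases (coverX_eq_iff x y).1 h' with h | h <;> simp [h])

theorem coordSq_coverX (i : Fin 3) (y : XTilde) :
    coordSq i (coverX y) = y.1 i ^ 2 / ‖y.1‖ ^ 2 := rfl

theorem continuous_coordSq (i : Fin 3) : Continuous (coordSq i) := by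
  refine Continuous.quotient_lift (Continuous.div (by fun_prop) (by fun_prop) fun y => ?_) _
  exact pow_ne_zero 2 (norm_ne_zero_iff.2 y.2)

theorem coordSq_nonneg (i : Fin 3) (b : X) : 0 ≤ coordSq i b := by
  obtain ⟨y, rfl⟩ := surjective_coverX b
  rw [coordSq_coverX]
  positivity

theorem sum_coordSq (b : X) : ∑ i, coordSq i b = 1 := by
  obtain ⟨y, rfl⟩ := surjective_coverX b
  simp only [coordSq_coverX]
  rw [← Finset.sum_div, EuclideanSpace.norm_sq_eq]
  simp only [Real.norm_eq_abs, sq_abs]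
  refine div_self ?_
  have h := pow_ne_zero 2 (norm_ne_zero_iff.2 y.2)
  simpa only [EuclideanSpace.norm_sq_eq, Real.norm_eq_abs, sq_abs] using h

theorem exists_pos_of_coordSq_ne_zero {i : Fin 3} {b : X} (h : coordSq i b ≠ 0) :
    ∃ y : XTilde, coverX y = b ∧ 0 < y.1 i := by
  obtain ⟨y, rfl⟩ := surjective_coverX b
  have hy : y.1 i ≠ 0 := by
    intro h0
    exact h (by rw [coordSq_coverX, h0]; simp)
  rcases hy.lt_or_gt with h1 | h1
  · exact ⟨(-1 : ℤˣ) • y, isQuotientCoveringMap_coverX.map_smul _, by simpa [coe_smul] using h1⟩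
  · exact ⟨y, rfl, h1⟩

/-- The partition of unity, indexed by `ℕ`. -/
noncomputable def weight (b : X) (n : ℕ) : ℝ := if h : n < 3 then coordSq ⟨n, h⟩ b else 0

theorem lt_of_weight_ne_zero {b : X} {n : ℕ} (h : weight b n ≠ 0) : n < 3 := by
  by_contra hn
  exact h (dif_neg hn)

theorem continuous_weight (n : ℕ) : Continuous fun b => weight b n := by
  unfold weight
  split_ifs with h
  · exact continuous_coordSq _
  · exact continuous_const

theorem support_weight_subset (b : X) : Function.support (weight b) ⊆ Finset.range 3 := by
  intro n hn
  simpa using lt_of_weight_ne_zero hn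

/-- The point of `EG` over a point of `X` with given group coordinates. -/
noncomputable def milnorPoint {G : Type*} [Group G] [TopologicalSpace G] (b : X) (κ : Fin 3 → G) :
    MilnorE G where
  wt := weight b
  wt_nonneg n := by
    unfold weight
    split_ifs
    · exact coordSq_nonneg _ _
    · exact le_rfl
  wt_finite := (Finset.finite_toSet _).subset (support_weight_subset b)
  wt_sum := by
    rw [finsum_eq_sum_of_support_subset _ (support_weight_subset b), ← sum_coordSq b,
      Finset.sum_range]
    exact Finset.sum_congr rfl fun i _ => dif_pos i.2
  coord n h := κ ⟨n, lt_of_weight_ne_zero h⟩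

theorem smul_milnorPoint {G : Type*} [Group G] [TopologicalSpace G] (g : G) (b : X) (κ : Fin 3 → G) :
    g • milnorPoint b κ = milnorPoint b fun i => g * κ i := rfl

/-! ### The classifying map -/

/-- The equivariant map from the frame bundle to `EAff(𝕋³)`. -/
noncomputable def classifyE (φ : Frames) : MilnorE (AffTorus 3) :=
  milnorPoint φ.base fun i => (φ.coord (posLift i φ.base))⁻¹

/-- In Milnor's topology the `i`-th group coordinate matters only where its weight is nonzero, and
there `posLift i` is continuous. -/
theorem continuous_classifyE : Continuous classifyE := by
  refine continuous_generateFrom_iff.2 ?_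
  rintro S (⟨n, U, hU, rfl⟩ | ⟨n, V, hV, rfl⟩)
  · exact hU.preimage ((continuous_weight n).comp Frames.continuous_base)
  · rw [isOpen_iff_mem_nhds]
    rintro φ₀ ⟨h₀, hV₀⟩
    change weight φ₀.base n ≠ 0 at h₀
    have hn := lt_of_weight_ne_zero h₀
    have h1 : ∀ᶠ φ in 𝓝 φ₀, weight (Frames.base φ) n ≠ 0 :=
      ((continuous_weight n).comp Frames.continuous_base).continuousAt.eventually_ne h₀
    have h2 : coordSq ⟨n, hn⟩ φ₀.base ≠ 0 := by
      rwa [weight, dif_pos hn] at h₀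
    obtain ⟨y, hy, hpos⟩ := exists_pos_of_coordSq_ne_zero h2
    have h3 := continuousAt_coord (φ₀ := φ₀) (sec := posLift ⟨n, hn⟩)
      (Filter.Eventually.of_forall (coverX_posLift _)) (hy ▸ continuousAt_posLift hpos)
    filter_upwards [h1, h3.eventually (hV.mem_nhds hV₀)] with φ h4 h5
    exact ⟨h4, h5⟩

theorem base_eq_of_act {g : AffTorus 3} {φ ψ : Frames} (h : ∀ t, ψ.1 (g.act t) = φ.1 t) :
    ψ.base = φ.base := by
  rw [← ψ.proj0_apply (g.act 0), h, φ.proj0_apply]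

/-- Reparametrising by `g` multiplies `coord` by `g` on the right; the inverses in `classifyE`
convert this to the left action. -/
theorem classifyE_equivariant (g : AffTorus 3) (φ ψ : Frames)
    (h : ∀ t, ψ.1 (g.act t) = φ.1 t) : classifyE ψ = g • classifyE φ := by
  have hb := base_eq_of_act h
  rw [classifyE, classifyE, smul_milnorPoint, hb]
  congr 1
  funext i
  set y := posLift i φ.base with hy
  have hyb : coverX y = φ.base := coverX_posLift i _
  have h1 : φ.coord y = ψ.coord y * g := by
    refine φ.coord_eq hyb fun t => ?_
    rw [AffTorus.act_mul, ← ψ.apply_eq (hyb.trans hb.symm), h]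
  rw [h1, mul_inv_rev, mul_inv_cancel_left]

/-- A classifying map of the principal bundle associated to `M₀ → X`. -/
noncomputable def classify : C(X, ClassifyingSpace (AffTorus 3)) where
  toFun := Quotient.lift
    (fun y : XTilde => (⟦classifyE (stdFrame y)⟧ : ClassifyingSpace (AffTorus 3))) (by
      rintro x y ⟨a, rfl⟩
      rcases Int.units_eq_one_or a with rfl | rfl
      · simp
      · exact Quotient.sound ⟨negAff,
          (classifyE_equivariant negAff (stdFrame y) _ (stdFrame_neg_apply y)).symm⟩)
  continuous_toFun :=
    (continuous_quotient_mk'.comp (continuous_classifyE.comp continuous_stdFrame)).quotient_lift _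

theorem classify_coverX (y : XTilde) : classify (coverX y) = ⟦classifyE (stdFrame y)⟧ := rfl

theorem isClassifyingMap_classify : IsClassifyingMap R3 3 omega0 proj0 classify := by
  refine ⟨⟨classifyE, continuous_classifyE⟩, classifyE_equivariant, fun φ => ?_⟩
  obtain ⟨y, hy⟩ := surjective_coverX (Frames.base φ)
  change classify (Frames.base φ) = ⟦classifyE φ⟧
  rw [← hy, classify_coverX]
  have h := classifyE_equivariant (Frames.coord φ y) φ (stdFrame y) fun t => (Frames.apply_eq φ hy t).symm
  rw [h]
  exact Quotient.sound ⟨_, rfl⟩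

/-! ### Lifting loops of `X` -/

/-- The lift ends at `x` or at `-x`. If it closed up, it would be contractible in `ℝ³ ∖ 0`, and its
projection would be trivial in `π₁(X)`. -/
theorem exists_lift_of_ne_one {b : X} {γ : Path b b} (h : FundamentalGroup.fromPath ⟦γ⟧ ≠ 1)
    {x : XTilde} (hx : coverX x = b) :
    ∃ Γ : Path x ((-1 : ℤˣ) • x), ∀ s, coverX (Γ s) = γ s := by
  have cov := isQuotientCoveringMap_coverX.isCoveringMap
  obtain ⟨Γ, hΓ, hΓ0⟩ := cov.exists_path_lifts γ x (by simp [hx])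
  have h1 : coverX (Γ 1) = coverX x := by
    rw [hx]
    simpa using congrFun hΓ 1
  rcases (coverX_eq_iff _ _).1 h1 with h2 | h2
  · exfalso
    apply h
    let Γ' : Path x x := ⟨Γ, hΓ0, Subtype.ext h2⟩
    have h3 : Γ'.Homotopic (Path.refl x) := SimplyConnectedSpace.paths_homotopic _ _
    subst hx
    have h4 : γ.Homotopic (Path.refl _) := by
      have h5 := h3.map ⟨coverX, continuous_coverX⟩
      have h6 : γ = Γ'.map continuous_coverX := Path.ext (funext fun s => (congrFun hΓ s).symm)
      rw [h6]
      exact h5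
    exact Quotient.sound h4
  · exact ⟨⟨Γ, hΓ0, Subtype.ext (by simp [h2, coe_smul])⟩, fun s => congrFun hΓ s⟩

/-! ### The universal bundle of a discrete group is a covering -/

section Milnor

theorem MilnorE.exists_wt_ne_zero {G : Type*} (p : MilnorE G) : ∃ i, p.wt i ≠ 0 := by
  by_contra h
  push Not at h
  have h1 := p.wt_sum
  simp [h] at h1

theorem isOpen_coord {G : Type*} [TopologicalSpace G] (i : ℕ) {V : Set G} (hV : IsOpen V) :
    IsOpen {p : MilnorE G | ∃ h : p.wt i ≠ 0, p.coord i h ∈ V} :=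
  TopologicalSpace.isOpen_generateFrom_of_mem (Or.inr ⟨i, V, hV, rfl⟩)

/-- The map `EG → EK` induced by a homomorphism. -/
def MilnorE.map {G K : Type*} [Group G] [Group K] (f : G →* K) (p : MilnorE G) : MilnorE K :=
  { p with coord := fun i h => f (p.coord i h) }

theorem MilnorE.map_smul {G K : Type*} [Group G] [Group K] (f : G →* K) (g : G) (p : MilnorE G) :
    MilnorE.map f (g • p) = f g • MilnorE.map f p := by
  change MilnorE.mk p.wt _ _ _ (fun i h => f (g * p.coord i h)) =
    MilnorE.mk p.wt _ _ _ fun i h => f g * f (p.coord i h)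
  simp only [_root_.map_mul]

variable {G K : Type*} [Group G] [TopologicalSpace G] [Group K] [TopologicalSpace K]

/-- Prescribing the value of one group coordinate is an open condition when `G` is discrete, and
nontrivial translates of the resulting set are disjoint from it. `Aff(𝕋ⁿ)` is not discrete, so this
is applied to its quotient `GL(n,ℤ)`. -/
theorem isQuotientCoveringMap_classifyingSpace [DiscreteTopology G] :
    IsQuotientCoveringMap (Quotient.mk _ : MilnorE G → ClassifyingSpace G) G where
  toIsQuotientMap := isQuotientMap_quotient_mk'
  continuous_const_smul g := by
    refine continuous_generateFrom_iff.2 ?_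
    rintro S (⟨i, U, hU, rfl⟩ | ⟨i, V, -, rfl⟩)
    · exact TopologicalSpace.isOpen_generateFrom_of_mem (Or.inl ⟨i, U, hU, rfl⟩)
    · exact isOpen_coord i (isOpen_discrete ((g * ·) ⁻¹' V))
  apply_eq_iff_mem_orbit := Quotient.eq
  disjoint e := by
    obtain ⟨i, hi⟩ := e.exists_wt_ne_zero
    refine ⟨_, (isOpen_coord i (isOpen_discrete {e.coord i hi})).mem_nhds ⟨hi, rfl⟩, ?_⟩
    rintro g ⟨_, ⟨p, ⟨h1, h2⟩, rfl⟩, ⟨h3, h4⟩⟩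
    have h5 : p.coord i h1 = e.coord i hi := h2
    have h6 : g * p.coord i h1 = e.coord i hi := h4
    rw [h5] at h6
    exact mul_eq_right.1 h6

theorem MilnorE.continuous_map {f : G →* K} (hf : Continuous f) : Continuous (MilnorE.map f) := by
  refine continuous_generateFrom_iff.2 ?_
  rintro S (⟨i, U, hU, rfl⟩ | ⟨i, V, hV, rfl⟩)
  · exact TopologicalSpace.isOpen_generateFrom_of_mem (Or.inl ⟨i, U, hU, rfl⟩)
  · exact isOpen_coord i (hV.preimage hf)

/-- The map `BG → BK` induced by a homomorphism. -/
def classifyingMap (f : G →* K) (hf : Continuous f) :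
    C(ClassifyingSpace G, ClassifyingSpace K) where
  toFun := Quotient.map (MilnorE.map f) (by
    rintro p q ⟨g, rfl⟩
    exact ⟨f g, (MilnorE.map_smul f g q).symm⟩)
  continuous_toFun := (continuous_quotient_mk'.comp (MilnorE.continuous_map hf)).quotient_lift _

/-- The elements of `G` by which the lifts of homotopic loops of `BG` differ at their end points
have conjugate images in a discrete group. -/
theorem conj_of_homotopic_loops [DiscreteTopology K] (f : G →* K) (hf : Continuous f)
    {x : ClassifyingSpace G} {l l₀ : Path x x} (hl : l.Homotopic l₀) {e e₀ : MilnorE G} {g g₀ : G}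
    (p : Path e (g • e)) (p₀ : Path e₀ (g₀ • e₀)) (hp : ∀ s, l s = ⟦p s⟧)
    (hp₀ : ∀ s, l₀ s = ⟦p₀ s⟧) : ∃ k, f g = k * f g₀ * k⁻¹ := by
  have hq := isQuotientCoveringMap_classifyingSpace (G := K)
  have cov := hq.isCoveringMap
  have hsm := hq.continuous_const_smul
  have hE := MilnorE.continuous_map hf
  have h0 : (⟦MilnorE.map f e₀⟧ : ClassifyingSpace K) = ⟦MilnorE.map f e⟧ := by
    have h1 : (⟦e₀⟧ : ClassifyingSpace G) = ⟦e⟧ := by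
      have h2 := hp 0
      have h3 := hp₀ 0
      simp only [Path.source] at h2 h3
      rw [← h2, ← h3]
    exact congrArg (classifyingMap f hf) h1
  -- The two lifts may start at different points of one orbit; translating the second by `k` gives a
  -- common start, and this `k` is the conjugating element.
  obtain ⟨k, hk⟩ := hq.apply_eq_iff_mem_orbit.1 h0.symm
  have hk' : k • MilnorE.map f e₀ = MilnorE.map f e := hk
  let P : C(I, MilnorE K) := ⟨fun s => MilnorE.map f (p s), hE.comp p.continuous⟩
  let P₀ : C(I, MilnorE K) := ⟨fun s => k • MilnorE.map f (p₀ s),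
    (hsm k).comp (hE.comp p₀.continuous)⟩
  have hL := hl.map (classifyingMap f hf)
  have hx : classifyingMap f hf x = ⟦MilnorE.map f e⟧ := by
    have h2 := hp 0
    simp only [Path.source] at h2
    rw [h2]
    rfl
  have e1 : P = cov.liftPath (l.map (classifyingMap f hf).continuous) (MilnorE.map f e)
      (by simpa using hx) := by
    refine (cov.eq_liftPath_iff' _).2 ⟨funext fun s => ?_, by simp [P]⟩
    change _ = classifyingMap f hf (l s)
    rw [hp]
    rfl
  have e2 : P₀ = cov.liftPath (l₀.map (classifyingMap f hf).continuous) (MilnorE.map f e)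
      (by simpa using hx) := by
    refine (cov.eq_liftPath_iff' _).2 ⟨funext fun s => ?_, by simp [P₀, hk']⟩
    change _ = classifyingMap f hf (l₀ s)
    rw [hp₀]
    exact hq.map_smul k
  -- Lifts of homotopic loops with a common start have a common end.
  have h3 : P 1 = P₀ 1 := by
    rw [e1, e2]
    exact cov.liftPath_apply_one_eq_of_homotopicRel hL _ _ _
  have h4 : MilnorE.map f (g • e) = k • MilnorE.map f (g₀ • e₀) := by
    simpa [P, P₀] using h3
  rw [MilnorE.map_smul, MilnorE.map_smul, ← hk', ← mul_smul, ← mul_smul] at h4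
  have := hq.isCancelSMul
  exact ⟨k, eq_mul_inv_of_mul_eq (IsCancelSMul.right_cancel _ _ _ h4)⟩

end Milnor

/-! ### The monodromy -/

instance {n : ℕ} : DiscreteTopology (GL (Fin n) ℤ) := by
  have : DiscreteTopology (Matrix (Fin n) (Fin n) ℤ) :=
    inferInstanceAs (DiscreteTopology (Fin n → Fin n → ℤ))
  exact Units.isEmbedding_embedProduct.discreteTopology

/-- The projection `Aff(𝕋ⁿ) → GL(n,ℤ)`. -/
def AffTorus.linHom (n : ℕ) : AffTorus n →* GL (Fin n) ℤ where
  toFun := AffTorus.lin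
  map_one' := rfl
  map_mul' _ _ := rfl

theorem AffTorus.continuous_linHom (n : ℕ) : Continuous (AffTorus.linHom n) :=
  continuous_fst.comp (continuous_induced_dom (f := fun g : AffTorus n => (g.lin, g.trans)))

/-- For any classifying map, the standard frames along a lift from `x` to `-x` give a path in `EAff`
ending at the `negAff`-translate of its start. Any other witness yields a conjugate of `-I`, which
is `-I`. -/
theorem isMonodromy_iff {b : X} {a : FundamentalGroup X b} (ha : a ≠ 1) (A : GL (Fin 3) ℤ) :
    IsMonodromy R3 3 omega0 proj0 b a A ↔ A = -1 := by
  obtain ⟨γ, rfl⟩ : ∃ γ : Path b b, FundamentalGroup.fromPath ⟦γ⟧ = a := Quotient.exists_rep a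
  obtain ⟨x, rfl⟩ := surjective_coverX b
  obtain ⟨Γ, hΓ⟩ := exists_lift_of_ne_one ha rfl
  have key : ∀ (f : C(X, ClassifyingSpace (AffTorus 3))) (F : C(Frames, MilnorE (AffTorus 3))),
      (∀ (g : AffTorus 3) (φ ψ : Frames), (∀ t, ψ.1 (g.act t) = φ.1 t) → F ψ = g • F φ) →
      (∀ φ : Frames, f (proj0 (φ.1 0)) = ⟦F φ⟧) →
      ∃ q : Path (F (stdFrame x)) (negAff • F (stdFrame x)),
        ∀ s, γ.map f.continuous s = ⟦q s⟧ := by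
    intro f F hF hf
    refine ⟨⟨⟨fun s => F (stdFrame (Γ s)), F.continuous.comp
      (continuous_stdFrame.comp Γ.continuous)⟩, by simp, ?_⟩, fun s => ?_⟩
    · simpa using hF negAff (stdFrame x) _ (stdFrame_neg_apply x)
    · have h := hf (stdFrame (Γ s))
      rw [Path.map_coe, Function.comp_apply, ← hΓ]
      exact h
  constructor
  · rintro ⟨f, ⟨F, hF, hf⟩, e, g, p, loop, hloop, hcl, rfl⟩
    obtain ⟨q, hq⟩ := key f F hF hf
    have hhom : loop.Homotopic (γ.map f.continuous) := Quotient.exact hcl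
    obtain ⟨k, hk⟩ := conj_of_homotopic_loops (AffTorus.linHom 3) (AffTorus.continuous_linHom 3)
      hhom p q hloop hq
    have h1 : AffTorus.linHom 3 negAff = -1 := rfl
    rw [h1, mul_neg, mul_one, neg_mul, mul_inv_cancel] at hk
    exact hk
  · rintro rfl
    obtain ⟨F, hF, hf⟩ := isClassifyingMap_classify
    obtain ⟨q, hq⟩ := key classify F hF hf
    exact ⟨classify, isClassifyingMap_classify, _, negAff, q, γ.map classify.continuous, hq, rfl, rfl⟩

/-! ### The flat connection in terms of the covering `ℝ³ ∖ 0 → X` -/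

/-- A chart of `X` that is a local inverse of `ℝ³ ∖ 0 → X` near `y`. -/
noncomputable def chartX (y : XTilde) : OpenPartialHomeomorph X R3 := (exists_chart_X y).choose

theorem chartX_mem_atlas (y : XTilde) : chartX y ∈ atlas R3 X := (exists_chart_X y).choose_spec.1

theorem mem_chartX_source (y : XTilde) : coverX y ∈ (chartX y).source :=
  (exists_chart_X y).choose_spec.2.1

theorem eventually_chartX (y : XTilde) : ∀ᶠ w in 𝓝 y, chartX y (coverX w) = w.1 :=
  (exists_chart_X y).choose_spec.2.2.1

theorem eventually_nhds_coverX {p : X → Prop} {y : XTilde} :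
    (∀ᶠ z in 𝓝 (coverX y), p z) ↔ ∀ᶠ w in 𝓝 y, p (coverX w) := by
  rw [← isLocalHomeomorph_coverX.map_nhds_eq y, Filter.eventually_map]

/-- The derivative at `b` of the local inverse of `ℝ³ ∖ 0 → X` through `y`. -/
noncomputable def sectDeriv (y : XTilde) (b : X) : R3 →L[ℝ] R3 :=
  mfderiv 𝓘(ℝ, R3) 𝓘(ℝ, R3) (chartX y) b

theorem mfderiv_eq_sectDeriv {y : XTilde} {c : OpenPartialHomeomorph X R3}
    (h : ∀ᶠ w in 𝓝 y, c (coverX w) = w.1) (v : R3) :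
    (mfderiv 𝓘(ℝ, R3) 𝓘(ℝ, R3) c (coverX y) v : R3) = sectDeriv y (coverX y) v := by
  have h1 : c =ᶠ[𝓝 (coverX y)] chartX y := by
    refine eventually_nhds_coverX.2 ?_
    filter_upwards [h, eventually_chartX y] with w h2 h3
    rw [h2, h3]
  have h2 : mfderiv 𝓘(ℝ, R3) 𝓘(ℝ, R3) c (coverX y) =
      mfderiv 𝓘(ℝ, R3) 𝓘(ℝ, R3) (chartX y) (coverX y) := h1.mfderiv_eq
  exact DFunLike.congr_fun h2 v

/-- The inverse branches through `y` and `-y` are negatives of each other; this sign is the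
holonomy. -/
theorem sectDeriv_neg (y : XTilde) (v : R3) :
    sectDeriv ((-1 : ℤˣ) • y) (coverX y) v = -sectDeriv y (coverX y) v := by
  have h1 : ∀ᶠ z in 𝓝 (coverX y), chartX ((-1 : ℤˣ) • y) z = (-1 : ℝ) • chartX y z + 0 := by
    rw [eventually_nhds_coverX]
    have h2 : ContinuousAt (fun w : XTilde => (-1 : ℤˣ) • w) y :=
      (continuous_const_smul (-1 : ℤˣ)).continuousAt
    filter_upwards [eventually_chartX y, h2.eventually (eventually_chartX ((-1 : ℤˣ) • y))]
      with w h3 h4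
    rw [isQuotientCoveringMap_coverX.map_smul] at h4
    rw [h3, h4]
    simp [coe_smul]
  have h2 := mfderiv_chart_of_eventually (chartX_mem_atlas y) (mem_chartX_source y) h1 v
  rw [neg_one_smul] at h2
  exact h2

theorem sectDeriv_bijective (y : XTilde) : Function.Bijective (sectDeriv y (coverX y)) :=
  (mdifferentiable_of_mem_atlas' (chartX_mem_atlas y)).mfderiv_bijective (mem_chartX_source y)

/-- The chain rule splits `dAction` into a Jacobian, which is locally constant, and the derivative
of the inverse branch, which does not involve `C`. -/
theorem dAction_eq {C : ActionAngleChart R3 3 omega0 proj0} {y : XTilde}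
    (hb : coverX y ∈ C.action.source) {c : OpenPartialHomeomorph X R3} (hc : c ∈ atlas R3 X)
    (hy : coverX y ∈ c.source) (hev : ∀ᶠ w in 𝓝 y, c (coverX w) = w.1) (v : R3) :
    (C.dAction (coverX y) v : R3) =
      fderiv ℝ (C.action ∘ c.symm) y.1 (sectDeriv y (coverX y) v) := by
  have hcy : c (coverX y) = y.1 := hev.self_of_nhds
  have hsx := C.action.left_inv hb
  have h1 := (contDiffAt_action_comp_chart_symm (C := C) hc (C.action.map_source hb)
    (hsx.symm ▸ hy)).differentiableAt (by simp)
  rw [hsx] at h1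
  have h2 : C.action =ᶠ[𝓝 (coverX y)] (C.action ∘ c.symm) ∘ c := by
    filter_upwards [c.open_source.mem_nhds hy] with z hz
    simp [c.left_inv hz]
  have h3 := (h1.hasFDerivAt.hasMFDerivAt.comp (coverX y)
    (mdifferentiableAt_of_mem_atlas hc hy).hasMFDerivAt).congr_of_eventuallyEq h2
  rw [hcy] at h3
  have h4 := DFunLike.congr_fun h3.mfderiv v
  refine h4.trans ?_
  exact congrArg (fderiv ℝ (C.action ∘ c.symm) y.1) (mfderiv_eq_sectDeriv hev v)

theorem eventually_eq_of_int {α : Type*} [TopologicalSpace α] {f : α → ℝ} {a : α}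
    (hf : ContinuousAt f a) (h : ∀ᶠ x in 𝓝 a, ∃ z : ℤ, f x = z) : ∀ᶠ x in 𝓝 a, f x = f a := by
  obtain ⟨z₀, h0⟩ := h.self_of_nhds
  filter_upwards [h, hf.eventually (Metric.ball_mem_nhds (f a) one_pos)] with x hx hx'
  obtain ⟨z, hz⟩ := hx
  rw [Real.dist_eq, hz, h0] at hx'
  have h1 : |z - z₀| < 1 := by exact_mod_cast hx'
  rw [hz, h0, sub_eq_zero.1 (Int.abs_lt_one_iff.1 h1)]

/-- The Jacobian of action coordinates is locally constant. -/
theorem eventually_fderiv_eq {C : ActionAngleChart R3 3 omega0 proj0} {y : XTilde}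
    (hb : coverX y ∈ C.action.source) {c : OpenPartialHomeomorph X R3} (hc : c ∈ atlas R3 X)
    (hy : coverX y ∈ c.source) (hev : ∀ᶠ w in 𝓝 y, c (coverX w) = w.1) :
    ∀ᶠ w in 𝓝 y, fderiv ℝ (C.action ∘ c.symm) w.1 = fderiv ℝ (C.action ∘ c.symm) y.1 := by
  have hcy : c (coverX y) = y.1 := hev.self_of_nhds
  have hsx := C.action.left_inv hb
  have h1 := contDiffAt_action_comp_chart_symm (C := C) hc (C.action.map_source hb)
    (hsx.symm ▸ hy)
  rw [hsx, hcy] at h1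
  have h2 : ContinuousAt (fun w : XTilde => fderiv ℝ (C.action ∘ c.symm) w.1) y :=
    (h1.fderiv_right (m := 0) (by simp)).continuousAt.comp continuousAt_subtype_val
  -- The entries of the Jacobian are those of a matrix in `GL(3,ℤ)`; continuous and integral, they
  -- cannot vary locally.
  have h3 : ∀ᶠ w in 𝓝 y, ∀ i j, ∃ z : ℤ,
      fderiv ℝ (C.action ∘ c.symm) w.1 (EuclideanSpace.single j 1) i = z := by
    filter_upwards [continuous_coverX.continuousAt.eventually (C.action.open_source.mem_nhds hb),
      continuous_coverX.continuousAt.eventually (c.open_source.mem_nhds hy),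
      hev.eventually_nhds] with w h4 h5 h6 i j
    obtain ⟨g, -, hg⟩ := exists_frame_eq h4 hc h5 h6
    exact ⟨g.lin j i, by simp [hg]⟩
  have h4 : ∀ᶠ w in 𝓝 y, ∀ i j,
      fderiv ℝ (C.action ∘ c.symm) w.1 (EuclideanSpace.single j 1) i =
      fderiv ℝ (C.action ∘ c.symm) y.1 (EuclideanSpace.single j 1) i := by
    rw [Filter.eventually_all]
    intro i
    rw [Filter.eventually_all]
    intro j
    refine eventually_eq_of_int ?_ (h3.mono fun w hw => hw i j)
    have h5 : Continuous fun L : R3 →L[ℝ] R3 => L (EuclideanSpace.single j 1) i := by fun_prop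
    exact h5.continuousAt.comp h2
  filter_upwards [h4] with w hw
  ext v i
  rw [← euclidean_sum_single v, map_sum, map_sum]
  simp only [map_smul, WithLp.ofLp_sum, Finset.sum_apply, PiLp.smul_apply, hw i]

theorem cast_covector_apply {b b' : X} (h : b = b') (α : TangentSpace 𝓘(ℝ, R3) b →L[ℝ] ℝ) (v : R3) :
    (h ▸ α : TangentSpace 𝓘(ℝ, R3) b' →L[ℝ] ℝ) v = α v := by
  subst h
  rfl

/-- A parallel field of covectors is constant in terms of the covering. -/
theorem exists_covector_of_isParallelAlong {b₀ b₁ : X} {γ : Path b₀ b₁}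
    {l : ∀ s : I, TangentSpace 𝓘(ℝ, R3) (γ s) →L[ℝ] ℝ}
    (hl : IsParallelAlong R3 3 omega0 proj0 γ l) {Γ : C(I, XTilde)}
    (hΓ : ∀ s, coverX (Γ s) = γ s) :
    ∃ k : R3 →L[ℝ] ℝ, ∀ s, ∀ v : R3, l s v = k (sectDeriv (Γ s) (γ s) v) := by
  have loc : ∀ s₀, ∃ k : R3 →L[ℝ] ℝ, ∀ᶠ s in 𝓝 s₀, ∀ v : R3,
      l s v = k (sectDeriv (Γ s) (γ s) v) := by
    intro s₀
    obtain ⟨C, k, hC, hk⟩ := hl s₀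
    rw [← hΓ] at hC
    have hc := chartX_mem_atlas (Γ s₀)
    have hy := mem_chartX_source (Γ s₀)
    have hev := eventually_chartX (Γ s₀)
    refine ⟨∑ i, k i • (EuclideanSpace.proj i).comp
      (fderiv ℝ (C.action ∘ (chartX (Γ s₀)).symm) (Γ s₀).1), ?_⟩
    have hΓc := Γ.continuous.continuousAt (x := s₀)
    have hcΓ := continuous_coverX.continuousAt.comp hΓc
    filter_upwards [hk, hΓc.eventually (eventually_fderiv_eq hC hc hy hev),
      hcΓ.eventually (C.action.open_source.mem_nhds hC),
      hcΓ.eventually ((chartX (Γ s₀)).open_source.mem_nhds hy),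
      hΓc.eventually hev.eventually_nhds] with s h1 h2 h3 h4 h5 v
    have h6 := dAction_eq h3 hc h4 h5 v
    rw [hΓ, h2] at h6
    refine (h1 v).trans ((Finset.sum_congr rfl fun i _ =>
      congrArg (fun u : R3 => k i * u i) h6).trans ?_)
    simp
  have hbij : ∀ s, Function.Bijective (sectDeriv (Γ s) (γ s)) := fun s => by
    rw [← hΓ]; exact sectDeriv_bijective _
  choose k hk using loc
  -- `sectDeriv` is onto, so `l s` determines the covector; the local choices therefore agree and
  -- are constant on the interval.
  have hconst : IsLocallyConstant k := by
    rw [IsLocallyConstant.iff_eventually_eq]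
    intro s₀
    filter_upwards [hk s₀] with s hs
    ext u
    obtain ⟨v, rfl⟩ := (hbij s).2 u
    rw [← hs, ← (hk s).self_of_nhds]
  refine ⟨k 0, fun s v => ?_⟩
  rw [(hk s).self_of_nhds, hconst.apply_eq_of_preconnectedSpace s 0]

/-- The actions of `stdChart` are an inverse branch of the covering, so `k` itself supplies the
constant coefficients, by its values on the basis. -/
theorem isParallelAlong_of_covector {b₀ b₁ : X} (γ : Path b₀ b₁) {Γ : C(I, XTilde)}
    (hΓ : ∀ s, coverX (Γ s) = γ s) (k : R3 →L[ℝ] ℝ) :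
    IsParallelAlong R3 3 omega0 proj0 γ fun s => k.comp (sectDeriv (Γ s) (γ s)) := by
  intro s₀
  obtain ⟨e, hy, he⟩ := isLocalHomeomorph_coverX (Γ s₀)
  refine ⟨stdChart e he.symm, fun i => k (EuclideanSpace.single i 1), ?_, ?_⟩
  · change γ s₀ ∈ (stdAction e).source
    rw [stdAction_source, ← hΓ, he]
    exact e.map_source hy
  · filter_upwards [Γ.continuous.continuousAt.eventually (e.open_source.mem_nhds hy)] with s hs v
    have h1 : ∀ᶠ w in 𝓝 (Γ s), stdAction e (coverX w) = w.1 := by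
      filter_upwards [e.open_source.mem_nhds hs] with w hw
      rw [stdAction_apply, he, e.left_inv hw]
    have h2 := mfderiv_eq_sectDeriv h1 v
    rw [hΓ] at h2
    change k (sectDeriv (Γ s) (γ s) v) = ∑ i, k (EuclideanSpace.single i 1) *
      (show R3 from mfderiv 𝓘(ℝ, R3) 𝓘(ℝ, R3) (stdAction e) (γ s) v) i
    rw [h2]
    conv_lhs => rw [← euclidean_sum_single (sectDeriv (Γ s) (γ s) v), map_sum]
    refine Finset.sum_congr rfl fun i _ => ?_
    rw [map_smul, smul_eq_mul, mul_comm]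

/-- A parallel field is `k ∘ sectDeriv` along the lift with `k` fixed, and `sectDeriv` changes sign
between its ends. -/
theorem isParallelTransport_iff {b : X} {γ : Path b b} (hγ : FundamentalGroup.fromPath ⟦γ⟧ ≠ 1)
    (α β : TangentSpace 𝓘(ℝ, R3) b →L[ℝ] ℝ) :
    IsParallelTransport R3 3 omega0 proj0 γ α β ↔ β = -α := by
  obtain ⟨x, hx⟩ := surjective_coverX b
  obtain ⟨Γ, hΓ⟩ := exists_lift_of_ne_one hγ hx
  have hneg : ∀ v, sectDeriv (Γ 1) (γ 1) v = -sectDeriv (Γ 0) (γ 0) v := by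
    intro v
    rw [Γ.source, Γ.target, γ.source, γ.target, ← hx]
    exact sectDeriv_neg x v
  constructor
  · rintro ⟨l, hl, h0, h1⟩
    obtain ⟨k, hk⟩ := exists_covector_of_isParallelAlong hl (Γ := Γ) hΓ
    have h0' : ∀ v : R3, l 0 v = α v := fun v => by rw [h0, cast_covector_apply]
    have h1' : ∀ v : R3, l 1 v = β v := fun v => by rw [h1, cast_covector_apply]
    refine ContinuousLinearMap.ext fun v => ?_
    refine (h1' v).symm.trans (((hk 1 v).trans ?_).trans (congrArg Neg.neg (h0' v)))
    refine (congrArg k (hneg v)).trans ((map_neg k _).trans ?_)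
    exact congrArg Neg.neg (hk 0 v).symm
  · rintro rfl
    have hbij : Function.Bijective (sectDeriv (Γ 0) (γ 0)) := by
      rw [← hΓ]; exact sectDeriv_bijective _
    -- Inverting `sectDeriv` at the start gives the covector `k` whose field begins at `α`.
    let E : R3 ≃L[ℝ] R3 := (LinearEquiv.ofBijective
      (sectDeriv (Γ 0) (γ 0) : R3 →ₗ[ℝ] R3) hbij).toContinuousLinearEquiv
    have hE : ∀ v : R3, E.symm (sectDeriv (Γ 0) (γ 0) v) = v := fun v => E.symm_apply_apply v
    let α' : R3 →L[ℝ] ℝ := α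
    refine ⟨_, isParallelAlong_of_covector γ (Γ := Γ) hΓ (α'.comp E.symm.toContinuousLinearMap),
      ?_, ?_⟩
    · refine ContinuousLinearMap.ext fun v => ?_
      refine Eq.trans ?_ (cast_covector_apply γ.source.symm α v).symm
      exact congrArg α' (hE v)
    · refine ContinuousLinearMap.ext fun v => ?_
      refine Eq.trans ?_ (cast_covector_apply γ.target.symm (-α) v).symm
      change α' (E.symm (sectDeriv (Γ 1) (γ 1) v)) = -α' v
      refine (congrArg (fun u => α' (E.symm u)) (hneg v)).trans ?_
      simp only [map_neg]
      exact congrArg (fun u => -α' u) (hE v)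

end LagFib

theorem mainTheorem6 :
    -- `M₀ → X` is a Lagrangian fibration with fibre `𝕋³`
    LagFib.IsLagrangianFibration LagFib.R3 3 (LagFib.Torus 3) LagFib.omega0 LagFib.proj0 ∧
    -- whose symplectic form is `∑ dxⁱ ∧ dtⁱ` in each local inverse of `(ℝ³ ∖ 0) × ℝ³ → M₀`
    (∀ c ∈ atlas (LagFib.R3 × LagFib.R3) LagFib.M0, ∀ m ∈ c.source, ∀ v w,
      LagFib.omega0 m v w = LagFib.stdForm (n := 3)
        (mfderiv 𝓘(ℝ, LagFib.R3 × LagFib.R3) 𝓘(ℝ, LagFib.R3 × LagFib.R3) c m v)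
        (mfderiv 𝓘(ℝ, LagFib.R3 × LagFib.R3) 𝓘(ℝ, LagFib.R3 × LagFib.R3) c m w)) ∧
    -- `X` is `ℝP² × ℝ`
    (∃ h : LagFib.X ≃ₜ ℙ ℝ LagFib.R3 × ℝ, ∀ x : LagFib.XTilde,
      h (LagFib.coverX x) = (Projectivization.mk ℝ x.1 x.2, Real.log ‖x.1‖)) ∧
    ∀ b : LagFib.X,
      -- the fundamental group has order two; let `a` be its generator
      Nat.card (FundamentalGroup LagFib.X b) = 2 ∧
      ∀ a : FundamentalGroup LagFib.X b, a ≠ 1 →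
        -- the monodromy sends `a` to `-I`
        (∀ A : GL (Fin 3) ℤ,
          LagFib.IsMonodromy LagFib.R3 3 LagFib.omega0 LagFib.proj0 b a A ↔ A = -1) ∧
        -- and so does the holonomy of the flat connection
        ∀ γ : Path b b, FundamentalGroup.fromPath ⟦γ⟧ = a →
          ∀ α β : TangentSpace 𝓘(ℝ, LagFib.R3) b →L[ℝ] ℝ,
            LagFib.IsParallelTransport LagFib.R3 3 LagFib.omega0 LagFib.proj0 γ α β ↔ β = -α := by
  refine ⟨LagFib.isLagrangianFibration_proj0, fun c hc m hm v w => LagFib.omega0_eq hc hm v w,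
    LagFib.exists_homeomorph_projectivePlane, fun b => ⟨LagFib.card_fundamentalGroup_X b,
      fun a ha => ⟨fun A => LagFib.isMonodromy_iff ha A, ?_⟩⟩⟩
  rintro γ rfl α β
  exact LagFib.isParallelTransport_iff ha α β
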